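/- For $m\ge 1$ let $\mathcal P_m$ be the group of all $m$-fold tensor products of elements of $\langle X,Z,iI_2\rangle\subset U(2)$, let $\mathrm{Cliff}(m)=\{U\in U(2^m): U\mathcal P_mU^\dagger\subseteq\mathcal P_m\}$, let $\mathcal C_m=\mathrm{Cliff}(m)/U(1)$ be the projective Clifford group, and write $[A]$ for the class of $A$ in $\mathcal C_m$. Let $\widetilde{\mathcal P}_m\trianglelefteq\mathcal C_m$ be the projective Pauli group, that is, the Pauli group modulo phases. For a one-qubit operator $A$ let $A_j$ be $A$ acting on the $j$-th qubit. Let $H$ be the Hadamard gate, let $CX_{1,2}$ be the controlled NOT with control qubit 1 and target qubit 2, and let $M=CX_{1,2}(Z_1H_1X_2)CX_{1,2}$. **Theorem.** Let $n\ge 2$ and let $\sigma$ be a nontrivial irreducible complex representation of $\widetilde{\mathcal P}_n$. Let $I_{\mathcal C_n}(\sigma)=\{g\in\mathcal C_n: {}^g\sigma\cong\sigma\}$ be its inertia subgroup, where ${}^g\sigma(x)=\sigma(g^{-1}xg)$. Then $I_{\mathcal C_n}(\sigma)$ is isomorphic to the subgroup $$IN_n=\langle [M],\,[H_1],\,[X_1],\,[I\otimes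 A] : A\in\mathrm{Cliff}(n-1)\rangle\le\mathcal C_n .$$ Moreover $\mathcal C_n$ is finite, and both $I_{\mathcal C_n}(\sigma)$ and $IN_n$ have index $4^n-1$ in $\mathcal C_n$ and order $2^{2n+1}\,|\mathcal C_{n-1}|$. -/

import Mathlib

open Matrix

noncomputable section

/-! ### Conjugate representations and inertia subgroups -/

namespace CliffordTheory

variable {G : Type*} [Group G] (N : Subgroup G) [N.Normal]
  {V : Type*} [AddCommGroup V] [Module ℂ V]

/-- The `g`-conjugate of a representation `σ` of a normal subgroup `N` of `G`:
`(ᵍσ)(x) = σ (g⁻¹ x g)` for `x ∈ N`. -/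
def conjRep (g : G) (σ : Representation ℂ N V) : Representation ℂ N V :=
  MonoidHom.comp σ (MulAut.conjNormal g⁻¹ : MulAut N).toMonoidHom

theorem conjRep_apply (g : G) (σ : Representation ℂ N V) (x : N) :
    conjRep N g σ x = σ ⟨g⁻¹ * x * g, by
      simpa using (inferInstance : N.Normal).conj_mem x x.2 g⁻¹⟩ := by
  simp only [conjRep, MonoidHom.comp_apply]
  congr 1
  ext
  simp

theorem conjRep_one (σ : Representation ℂ N V) : conjRep N 1 σ = σ := by
  ext x : 1
  simp [conjRep_apply]

theorem conjRep_mul (g h : G) (σ : Representation ℂ N V) :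
    conjRep N (g * h) σ = conjRep N g (conjRep N h σ) := by
  ext x : 1
  simp [conjRep_apply, mul_assoc]

/-- Conjugating two isomorphic representations gives isomorphic representations. -/
theorem conjRep_equiv (g : G) {σ τ : Representation ℂ N V} (h : Nonempty (σ.Equiv τ)) :
    Nonempty ((conjRep N g σ).Equiv (conjRep N g τ)) := by
  obtain ⟨e⟩ := h
  exact ⟨Representation.Equiv.mk e.toLinearEquiv fun x => e.isIntertwining' _⟩

/-- The inertia subgroup `I_G(σ) = {g ∈ G : ᵍσ ∼ σ}`. -/
def inertiaSubgroup (σ : Representation ℂ N V) : Subgroup G where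
  carrier := {g | Nonempty ((conjRep N g σ).Equiv σ)}
  one_mem' := by
    simp only [Set.mem_ofPred_eq, conjRep_one]
    exact ⟨Representation.Equiv.refl σ⟩
  mul_mem' := by
    rintro g h hg hh
    simp only [Set.mem_ofPred_eq] at *
    rw [conjRep_mul]
    obtain ⟨e⟩ := conjRep_equiv N g hh
    obtain ⟨f⟩ := hg
    exact ⟨e.trans f⟩
  inv_mem' := by
    rintro g hg
    simp only [Set.mem_ofPred_eq] at *
    obtain ⟨e⟩ := conjRep_equiv N g⁻¹ hg
    rw [← conjRep_mul, inv_mul_cancel, conjRep_one] at e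
    exact ⟨e.symm⟩

end CliffordTheory

/-! ### Unitary operators on qubits -/

namespace Qubits

/-- Unitary operators on `n` qubits. The basis vectors of `(ℂ²)^{⊗ n}` are
`v_{x 0} ⊗ ⋯ ⊗ v_{x (n-1)}` with `x : Fin n → Fin 2`. -/
abbrev U (n : ℕ) : Type := Matrix.unitaryGroup (Fin n → Fin 2) ℂ

/-- Unitary operators on `ℂ²`. -/
abbrev U₁ : Type := Matrix.unitaryGroup (Fin 2) ℂ

/-- The Pauli operator `X v_l = v_{l+1}`. -/
def X : U₁ := ⟨!![0, 1; 1, 0], by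
  rw [mem_unitaryGroup_iff, ← Matrix.ext_iff]
  simp [Fin.forall_fin_two, star_eq_conjTranspose, Matrix.mul_apply]⟩

/-- The Pauli operator `Z v_l = (-1)^l v_l`. -/
def Z : U₁ := ⟨!![1, 0; 0, -1], by
  rw [mem_unitaryGroup_iff, ← Matrix.ext_iff]
  simp [Fin.forall_fin_two, star_eq_conjTranspose, Matrix.mul_apply]⟩

/-- The scalar operator `i I₂`. -/
def iI : U₁ := ⟨!![Complex.I, 0; 0, Complex.I], by
  rw [mem_unitaryGroup_iff, ← Matrix.ext_iff]
  simp [Fin.forall_fin_two, star_eq_conjTranspose, Matrix.mul_apply]⟩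

/-- The Hadamard gate. -/
def H : U₁ := ⟨!![1 / (√2 : ℝ), 1 / (√2 : ℝ); 1 / (√2 : ℝ), -1 / (√2 : ℝ)], by
  have h : ((√2 : ℝ) : ℂ)⁻¹ * ((√2 : ℝ) : ℂ)⁻¹ = 1 / 2 := by
    rw [← mul_inv, ← Complex.ofReal_mul, Real.mul_self_sqrt (by norm_num)]
    norm_num
  rw [mem_unitaryGroup_iff, ← Matrix.ext_iff]
  simp [Fin.forall_fin_two, star_eq_conjTranspose, Matrix.mul_apply, neg_div, h]
  norm_num⟩

/-- The matrix of the tensor product `A 0 ⊗ ⋯ ⊗ A (n-1)` of `2 × 2` matrices. -/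
def tensorMatrix {n : ℕ} (A : Fin n → Matrix (Fin 2) (Fin 2) ℂ) :
    Matrix (Fin n → Fin 2) (Fin n → Fin 2) ℂ :=
  Matrix.of fun x y => ∏ i, A i (x i) (y i)

theorem tensorMatrix_mul {n : ℕ} (A B : Fin n → Matrix (Fin 2) (Fin 2) ℂ) :
    tensorMatrix (fun i => A i * B i) = tensorMatrix A * tensorMatrix B := by
  ext x y
  simp only [tensorMatrix, Matrix.of_apply, Matrix.mul_apply, Finset.prod_univ_sum,
    Fintype.piFinset_univ, Finset.prod_mul_distrib]

theorem tensorMatrix_one {n : ℕ} :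
    tensorMatrix (fun _ : Fin n => (1 : Matrix (Fin 2) (Fin 2) ℂ)) = 1 := by
  ext x y
  simp [tensorMatrix, Matrix.one_apply, Finset.prod_ite_zero, funext_iff]

theorem tensorMatrix_star {n : ℕ} (A : Fin n → Matrix (Fin 2) (Fin 2) ℂ) :
    star (tensorMatrix A) = tensorMatrix (fun i => star (A i)) := by
  ext x y
  simp [tensorMatrix]

/-- The tensor product of one-qubit unitaries, as a homomorphism `U(2)ⁿ → U(2ⁿ)`. -/
def tensor (n : ℕ) : (Fin n → U₁) →* U n where
  toFun A := ⟨tensorMatrix fun i => (A i : Matrix (Fin 2) (Fin 2) ℂ), by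
    rw [mem_unitaryGroup_iff, tensorMatrix_star, ← tensorMatrix_mul, ← tensorMatrix_one]
    congr 1
    funext i
    exact mem_unitaryGroup_iff.1 (A i).2⟩
  map_one' := Subtype.ext tensorMatrix_one
  map_mul' A B := Subtype.ext (tensorMatrix_mul _ _)

/-- The one-qubit operator `A` acting on the qubit `j`:
`A_j = I ⊗ ⋯ ⊗ I ⊗ A ⊗ I ⊗ ⋯ ⊗ I` with `A` in position `j`. -/
def onQubit {n : ℕ} (j : Fin n) (A : U₁) : U n := tensor n (Pi.mulSingle j A)

/-- The tensor product `B ⊗ A` of an operator `B` on one qubit and an operator `A` on `n` further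
qubits, as a homomorphism `U(2) × U(2ⁿ) → U(2ⁿ⁺¹)`. -/
def tensorSucc (n : ℕ) : U₁ × U n →* U (n + 1) where
  toFun p := ⟨Matrix.of fun x y => p.1.1 (x 0) (y 0) * p.2.1 (Fin.tail x) (Fin.tail y), by
    have h := kronecker_mem_unitary p.1.2 p.2.2
    have h2 : (Matrix.of fun x y : Fin (n + 1) → Fin 2 =>
        p.1.1 (x 0) (y 0) * p.2.1 (Fin.tail x) (Fin.tail y)) =
        Matrix.reindexAlgEquiv ℂ ℂ (Fin.consEquiv fun _ => Fin 2)
          (Matrix.kronecker p.1.1 p.2.1) := by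
      ext x y
      simp [Fin.consEquiv, Matrix.kroneckerMap_apply]
    rw [mem_unitaryGroup_iff] at h ⊢
    rw [h2, show star (Matrix.reindexAlgEquiv ℂ ℂ (Fin.consEquiv fun _ => Fin 2)
          (Matrix.kronecker p.1.1 p.2.1)) =
        Matrix.reindexAlgEquiv ℂ ℂ (Fin.consEquiv fun _ => Fin 2)
          (star (Matrix.kronecker p.1.1 p.2.1)) from rfl, ← map_mul]
    exact (congrArg _ h).trans (map_one _)⟩
  map_one' := by
    ext x y
    have h : x = y ↔ x 0 = y 0 ∧ Fin.tail x = Fin.tail y := by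
      refine ⟨fun h => by simp [h], fun h => ?_⟩
      rw [← Fin.cons_self_tail x, ← Fin.cons_self_tail y, h.1, h.2]
    simp only [Prod.fst_one, Prod.snd_one, UnitaryGroup.one_val, Matrix.of_apply,
      Matrix.one_apply, h]
    split_ifs <;> simp_all
  map_mul' p q := by
    ext x y
    simp only [Prod.fst_mul, Prod.snd_mul, UnitaryGroup.mul_val, Matrix.of_apply,
      Matrix.mul_apply]
    rw [← (Fin.consEquiv fun _ => Fin 2).sum_comp, Fintype.sum_prod_type, Finset.sum_mul_sum]
    refine Finset.sum_congr rfl fun i _ => Finset.sum_congr rfl fun j _ => ?_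
    have h0 : (Fin.consEquiv fun _ : Fin (n + 1) => Fin 2) (i, j) 0 = i := rfl
    have h1 : Fin.tail ((Fin.consEquiv fun _ : Fin (n + 1) => Fin 2) (i, j)) = j := rfl
    rw [h0, h1]
    ring

/-- The classical map of the controlled NOT: add the bit `c` to the bit `t`, modulo 2. -/
def cnotPerm {n : ℕ} (c t : Fin n) (h : c ≠ t) : Equiv.Perm (Fin n → Fin 2) :=
  Function.Involutive.toPerm (fun x => Function.update x t (x t + x c)) <| by
    intro x
    have h2 : ∀ a b : Fin 2, a + b + b = a := by decide
    simp [Function.update_of_ne h, h2]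

theorem cnotPerm_apply {n : ℕ} (c t : Fin n) (h : c ≠ t) (x : Fin n → Fin 2) :
    cnotPerm c t h x = Function.update x t (x t + x c) := rfl

theorem cnotPerm_inv {n : ℕ} (c t : Fin n) (h : c ≠ t) :
    (cnotPerm c t h)⁻¹ = cnotPerm c t h := rfl

/-- The controlled NOT gate `CX_{c,t}` with control `c` and target `t`:
it sends the basis vector `x` to the basis vector `cnotPerm c t h x`. -/
def CX {n : ℕ} (c t : Fin n) (h : c ≠ t) : U n :=
  ⟨(cnotPerm c t h).permMatrix ℂ, by
    rw [mem_unitaryGroup_iff, star_eq_conjTranspose, conjTranspose_permMatrix, ← permMatrix_mul]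
    simp⟩

/-- The scalar operators, as a homomorphism `U(1) → U(2ⁿ)`. -/
def phase (n : ℕ) : Circle →* U n where
  toFun z := ⟨(z : ℂ) • 1, by
    rw [mem_unitaryGroup_iff, star_smul, smul_mul_smul_comm]
    have hz : (z : ℂ) * star (z : ℂ) = 1 := by
      rw [Complex.star_def, Complex.mul_conj, Circle.normSq_coe, Complex.ofReal_one]
    rw [hz, one_smul, star_one, one_mul]⟩
  map_one' := by ext; simp
  map_mul' z w := by
    ext
    simp
    ring

/-! ### The Pauli and Clifford groups -/

/-- The one-qubit Pauli group `⟨X, Z, i I₂⟩`. -/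
def pauliOne : Subgroup U₁ := Subgroup.closure {X, Z, iI}

/-- The `n`-qubit Pauli group: all `n`-fold tensor products of elements of the one-qubit Pauli
group. -/
def pauli (n : ℕ) : Subgroup (U n) :=
  (Subgroup.pi Set.univ fun _ => pauliOne).map (tensor n)

/-- The `n`-qubit Clifford group: the normalizer of the Pauli group in `U(2ⁿ)`. -/
def Cliff (n : ℕ) : Subgroup (U n) := Subgroup.normalizer (pauli n : Set (U n))

/-- The subgroup `U(1)` of all phases, inside the Clifford group. -/
def phases (n : ℕ) : Subgroup (Cliff n) := (phase n).range.subgroupOf (Cliff n)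

instance phases_normal (n : ℕ) : (phases n).Normal := by
  refine ⟨?_⟩
  rintro a ⟨z, hz⟩ g
  refine ⟨z, ?_⟩
  have hc : ∀ u : U n, u * phase n z = phase n z * u := by
    intro u
    ext x y
    simp [phase]
  simp only [Subgroup.coe_subtype, Subgroup.coe_mul, Subgroup.coe_inv] at hz ⊢
  rw [← hz, hc, mul_inv_cancel_right]

/-- The `n`-qubit projective Clifford group `Cliff(n) / U(1)`. -/
abbrev ProjCliff (n : ℕ) : Type := Cliff n ⧸ phases n

/-- The class `[A]` in the projective Clifford group. -/
abbrev cls {n : ℕ} (A : Cliff n) : ProjCliff n := QuotientGroup.mk A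

/-- The `n`-qubit projective Pauli group: the Pauli group modulo phases, as a subgroup of the
projective Clifford group. -/
def projPauli (n : ℕ) : Subgroup (ProjCliff n) :=
  ((pauli n).subgroupOf (Cliff n)).map (QuotientGroup.mk' (phases n))

instance projPauli_normal (n : ℕ) : (projPauli n).Normal := by
  have : ((pauli n).subgroupOf (Cliff n)).Normal := Subgroup.normal_in_normalizer
  exact this.map _ (QuotientGroup.mk'_surjective _)

/-! ### The gates used as generators lie in the Clifford group -/

theorem pauli_le_Cliff (n : ℕ) : pauli n ≤ Cliff n := Subgroup.le_normalizer

theorem X_mem : X ∈ pauliOne := Subgroup.subset_closure (by simp)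
theorem Z_mem : Z ∈ pauliOne := Subgroup.subset_closure (by simp)
theorem iI_mem : iI ∈ pauliOne := Subgroup.subset_closure (by simp)

theorem tensor_mem {n : ℕ} {P : Fin n → U₁} (h : ∀ i, P i ∈ pauliOne) : tensor n P ∈ pauli n :=
  ⟨P, fun i _ => h i, rfl⟩

theorem mem_normalizer_of_involutive {G : Type*} [Group G] (K : Subgroup G) (g : G)
    (hg : g * g = 1) (h : ∀ k ∈ K, g * k * g⁻¹ ∈ K) : g ∈ Subgroup.normalizer (K : Set G) := by
  rw [Subgroup.mem_normalizer_iff]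
  refine fun k => ⟨h k, fun hk => ?_⟩
  have h2 := h _ hk
  have h3 : g⁻¹ = g := inv_eq_of_mul_eq_one_left hg
  rw [h3] at h2
  simpa [mul_assoc, hg, ← mul_assoc g g] using h2

theorem H_mul_H : H * H = 1 := by
  have h : ((√2 : ℝ) : ℂ)⁻¹ * ((√2 : ℝ) : ℂ)⁻¹ = 1 / 2 := by
    rw [← mul_inv, ← Complex.ofReal_mul, Real.mul_self_sqrt (by norm_num)]
    norm_num
  apply Subtype.ext
  rw [← Matrix.ext_iff]
  simp [Fin.forall_fin_two, H, neg_div, h]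
  norm_num

theorem H_mul_X : H * X = Z * H := by
  apply Subtype.ext
  rw [← Matrix.ext_iff]
  simp [H, X, Z, neg_div]

theorem H_mul_Z : H * Z = X * H := by
  apply Subtype.ext
  rw [← Matrix.ext_iff]
  simp [H, X, Z, neg_div]

theorem H_mul_iI : H * iI = iI * H := by
  apply Subtype.ext
  rw [← Matrix.ext_iff]
  simp [H, iI, neg_div, mul_comm]

theorem H_mem : H ∈ Subgroup.normalizer (pauliOne : Set U₁) := by
  refine mem_normalizer_of_involutive _ _ H_mul_H fun k hk => ?_
  have h : pauliOne ≤ pauliOne.comap (MulAut.conj H).toMonoidHom := by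
    rw [pauliOne, Subgroup.closure_le, ← pauliOne]
    rintro k (rfl | rfl | rfl)
    · simpa [H_mul_X] using Z_mem
    · simpa [H_mul_Z] using X_mem
    · simpa [H_mul_iI] using iI_mem
  simpa using h hk

/-- A one-qubit operator that normalizes the one-qubit Pauli group is a Clifford operator on each
qubit. -/
theorem onQubit_mem {n : ℕ} (j : Fin n) {A : U₁}
    (hA : A ∈ Subgroup.normalizer (pauliOne : Set U₁)) : onQubit j A ∈ Cliff n := by
  have key : ∀ A ∈ Subgroup.normalizer (pauliOne : Set U₁), ∀ p ∈ pauli n,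
      onQubit j A * p * (onQubit j A)⁻¹ ∈ pauli n := by
    rintro A hA _ ⟨P, hP, rfl⟩
    rw [onQubit, ← map_inv, ← map_mul, ← map_mul]
    refine tensor_mem fun i => ?_
    have hPi : P i ∈ pauliOne := hP i trivial
    rcases eq_or_ne i j with rfl | hij
    · simpa using (Subgroup.mem_normalizer_iff.1 hA _).1 hPi
    · simpa [hij] using hPi
  refine Subgroup.mem_normalizer_iff.2 fun p => ⟨key A hA p, fun hp => ?_⟩
  have h := key A⁻¹ (inv_mem hA) _ hp
  have hi : onQubit j A⁻¹ = (onQubit j A)⁻¹ := by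
    simp [onQubit, Pi.mulSingle_inv]
  rw [hi] at h
  simpa [mul_assoc] using h

/-- The operator `I ⊗ A` is a Clifford operator when `A` is one. -/
theorem id_tensor_mem {n : ℕ} {A : U n} (hA : A ∈ Cliff n) : tensorSucc n (1, A) ∈ Cliff (n + 1) := by
  have hsplit : ∀ P : Fin (n + 1) → U₁,
      tensor (n + 1) P = tensorSucc n (P 0, tensor n (Fin.tail P)) := by
    intro P
    ext x y
    simp [tensor, tensorSucc, tensorMatrix, Fin.prod_univ_succ, Fin.tail]
  have key : ∀ A ∈ Cliff n, ∀ p ∈ pauli (n + 1),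
      tensorSucc n (1, A) * p * (tensorSucc n (1, A))⁻¹ ∈ pauli (n + 1) := by
    rintro A hA _ ⟨P, hP, rfl⟩
    have hPi : ∀ i, P i ∈ pauliOne := fun i => hP i trivial
    obtain ⟨Q, hQ, hQe⟩ := (Subgroup.mem_normalizer_iff.1 hA _).1
      (tensor_mem fun i => hPi (Fin.succ i))
    have h2 : tensorSucc n (1, A) * tensor (n + 1) P * (tensorSucc n (1, A))⁻¹ =
        tensor (n + 1) (Fin.cons (P 0) Q : Fin (n + 1) → U₁) := by
      rw [hsplit, hsplit, Fin.cons_zero, Fin.tail_cons, hQe, ← map_inv, ← map_mul, ← map_mul]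
      simp only [Prod.mk_mul_mk, Prod.inv_mk, one_mul, inv_one, mul_one]
      rfl
    rw [h2]
    refine tensor_mem fun i => ?_
    refine Fin.cases ?_ (fun i => ?_) i
    · simpa using hPi 0
    · simpa using hQ i trivial
  refine Subgroup.mem_normalizer_iff.2 fun p => ⟨key A hA p, fun hp => ?_⟩
  have h := key A⁻¹ (inv_mem hA) _ hp
  have hi : tensorSucc n (1, A⁻¹) = (tensorSucc n (1, A))⁻¹ := by
    rw [← map_inv]; simp
  rw [hi] at h
  simpa [mul_assoc] using h

theorem CX_mul_CX {n : ℕ} (c t : Fin n) (h : c ≠ t) : CX c t h * CX c t h = 1 := by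
  apply Subtype.ext
  change (cnotPerm c t h).permMatrix ℂ * (cnotPerm c t h).permMatrix ℂ = 1
  rw [← permMatrix_mul]
  nth_rw 1 [← cnotPerm_inv]
  simp

theorem CX_conj_apply {n : ℕ} (c t : Fin n) (h : c ≠ t) (A : U n) (x y : Fin n → Fin 2) :
    (CX c t h * A * (CX c t h)⁻¹).1 x y = A.1 (cnotPerm c t h x) (cnotPerm c t h y) := by
  rw [inv_eq_of_mul_eq_one_left (CX_mul_CX c t h)]
  change ((cnotPerm c t h).permMatrix ℂ * A.1 * (cnotPerm c t h).permMatrix ℂ) x y = _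
  rw [Equiv.Perm.permMatrix, PEquiv.toMatrix_toPEquiv_mul, PEquiv.mul_toMatrix_toPEquiv]
  rfl

/-- Conjugation of a tensor product by a controlled NOT only changes the factors at the control
and at the target. -/
theorem CX_conj_tensor {n : ℕ} (c t : Fin n) (h : c ≠ t) (P Q : Fin n → U₁)
    (hPQ : ∀ i, i ≠ c → i ≠ t → P i = Q i)
    (hct : ∀ a b a' b' : Fin 2, (P c).1 a a' * (P t).1 (b + a) (b' + a') =
      (Q c).1 a a' * (Q t).1 b b') :
    CX c t h * tensor n P * (CX c t h)⁻¹ = tensor n Q := by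
  ext x y
  rw [CX_conj_apply]
  change (∏ i, (P i).1 (cnotPerm c t h x i) (cnotPerm c t h y i)) = ∏ i, (Q i).1 (x i) (y i)
  have ht : t ∈ Finset.univ.erase c := by simp [h.symm]
  rw [← Finset.mul_prod_erase _ _ (Finset.mem_univ c), ← Finset.mul_prod_erase _ _ ht,
    ← Finset.mul_prod_erase _ _ (Finset.mem_univ c), ← Finset.mul_prod_erase _ _ ht,
    ← mul_assoc, ← mul_assoc]
  congr 1
  · simpa [cnotPerm_apply, Function.update_of_ne h] using hct (x c) (x t) (y c) (y t)
  · refine Finset.prod_congr rfl fun i hi => ?_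
    have hit : i ≠ t := by simp at hi; exact hi.1
    have hic : i ≠ c := by simp at hi; exact hi.2
    simp [cnotPerm_apply, Function.update_of_ne hit, hPQ i hic hit]

theorem CX_mem {n : ℕ} (c t : Fin n) (h : c ≠ t) : CX c t h ∈ Cliff n := by
  refine mem_normalizer_of_involutive _ _ (CX_mul_CX c t h) fun k hk => ?_
  suffices hle : pauli n ≤ (pauli n).comap (MulAut.conj (CX c t h)).toMonoidHom by
    simpa using hle hk
  have gen : ∀ (j : Fin n) (A Qc Qt : U₁), A ∈ pauliOne → Qc ∈ pauliOne → Qt ∈ pauliOne →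
      (∀ a b a' b' : Fin 2, ((Pi.mulSingle j A : Fin n → U₁) c).1 a a' *
        ((Pi.mulSingle j A : Fin n → U₁) t).1 (b + a) (b' + a') = Qc.1 a a' * Qt.1 b b') →
      CX c t h * tensor n (Pi.mulSingle j A) * (CX c t h)⁻¹ ∈ pauli n := by
    intro j A Qc Qt hA hc ht hrel
    rw [CX_conj_tensor c t h _
      (Function.update (Function.update (Pi.mulSingle j A : Fin n → U₁) c Qc) t Qt)
      (fun i hic hit => by simp [hic, hit]) (by simpa [Function.update_of_ne h] using hrel)]
    refine tensor_mem fun i => ?_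
    by_cases hit : i = t
    · subst hit; simpa using ht
    by_cases hic : i = c
    · subst hic; simpa [hit] using hc
    by_cases hij : i = j
    · subst hij; simpa [hit, hic] using hA
    · simp [hit, hic, hij]
  rw [pauli, Subgroup.map_le_iff_le_comap, Subgroup.pi_le_iff, ← pauli]
  intro j
  rw [Subgroup.map_le_iff_le_comap, pauliOne, Subgroup.closure_le]
  have h1 := one_mem pauliOne
  have htc := h.symm
  rintro A (rfl | rfl | rfl)
  · by_cases hc : c = j
    · subst hc
      refine gen _ _ X X X_mem X_mem X_mem ?_
      simp [Fin.forall_fin_two, X, htc, Matrix.one_apply]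
    by_cases ht : t = j
    · subst ht
      refine gen _ _ 1 X X_mem h1 X_mem ?_
      simp [Fin.forall_fin_two, X, h, Matrix.one_apply]
    refine gen _ _ 1 1 X_mem h1 h1 ?_
    simp [Fin.forall_fin_two, hc, ht, Matrix.one_apply]
  · by_cases hc : c = j
    · subst hc
      refine gen _ _ Z 1 Z_mem Z_mem h1 ?_
      simp [Fin.forall_fin_two, Z, htc, Matrix.one_apply]
    by_cases ht : t = j
    · subst ht
      refine gen _ _ Z Z Z_mem Z_mem Z_mem ?_
      simp [Fin.forall_fin_two, Z, h, Matrix.one_apply]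
    refine gen _ _ 1 1 Z_mem h1 h1 ?_
    simp [Fin.forall_fin_two, hc, ht, Matrix.one_apply]
  · by_cases hc : c = j
    · subst hc
      refine gen _ _ iI 1 iI_mem iI_mem h1 ?_
      simp [Fin.forall_fin_two, iI, htc, Matrix.one_apply]
    by_cases ht : t = j
    · subst ht
      refine gen _ _ 1 iI iI_mem h1 iI_mem ?_
      simp [Fin.forall_fin_two, iI, h, Matrix.one_apply]
    refine gen _ _ 1 1 iI_mem h1 h1 ?_
    simp [Fin.forall_fin_two, hc, ht, Matrix.one_apply]

/-! ### The subgroup `IN_n` -/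

/-- The Hadamard gate on the qubit `j`, as a Clifford operator. -/
def cH {n : ℕ} (j : Fin n) : Cliff n := ⟨onQubit j H, onQubit_mem j H_mem⟩

/-- The operator `X` on the qubit `j`, as a Clifford operator. -/
def cX {n : ℕ} (j : Fin n) : Cliff n :=
  ⟨onQubit j X, onQubit_mem j (Subgroup.le_normalizer X_mem)⟩

/-- The operator `Z` on the qubit `j`, as a Clifford operator. -/
def cZ {n : ℕ} (j : Fin n) : Cliff n :=
  ⟨onQubit j Z, onQubit_mem j (Subgroup.le_normalizer Z_mem)⟩

/-- The controlled NOT with control `c` and target `t`, as a Clifford operator. -/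
def cCX {n : ℕ} (c t : Fin n) (h : c ≠ t) : Cliff n := ⟨CX c t h, CX_mem c t h⟩

/-- The Clifford operator `M = CX_{1,2} (Z₁ H₁ X₂) CX_{1,2}`. The first and the second qubit have
the indices `0` and `1`. -/
def M (n : ℕ) : Cliff (n + 2) :=
  cCX 0 1 Fin.zero_ne_one * (cZ 0 * cH 0 * cX 1) * cCX 0 1 Fin.zero_ne_one

/-- The Clifford operator `I ⊗ A` on `n + 1` qubits, for a Clifford operator `A` on the last `n`
qubits. -/
def idTensor {n : ℕ} (A : Cliff n) : Cliff (n + 1) := ⟨tensorSucc n (1, A.1), id_tensor_mem A.2⟩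

/-- The subgroup `IN_n = ⟨[M], [H₁], [X₁], [I ⊗ A] : A ∈ Cliff(n-1)⟩` of the projective Clifford
group. It is only meaningful for `n ≥ 2`; for `n = 0` and `n = 1` the value is arbitrary. -/
def IN : (n : ℕ) → Subgroup (ProjCliff n)
  | 0 => ⊥
  | 1 => ⊥
  | n + 2 => Subgroup.closure
      ({cls (M n), cls (cH 0), cls (cX 0)} ∪ Set.range fun A : Cliff (n + 1) => cls (idTensor A))

end Qubits

end

/-!
Label the classes of `n`-qubit Pauli operators modulo phases by vectors of `𝔽₂²ⁿ`. Two Pauli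
operators commute up to a sign, `sign a b`, which is a nondegenerate symplectic pairing of their
labels. The projective Clifford group acts on labels by conjugation, additively and preserving the
pairing.

*Inertia subgroups are stabilizers.* Every projective Pauli operator squares to one, so an
irreducible representation of the projective Pauli group acts through `±1`. Since the pairing is
nondegenerate, it is a multiple of the character `sign r` for some label `r`, with `r ≠ 0` when the
representation is nontrivial (`exists_label_of_isIrreducible`). Its inertia subgroup is the
stabilizer of `r` (`inertiaSubgroup_eq_stabilizer`).

*Nonzero labels form one orbit.* For a Pauli operator `S`, normalized so that `S² = -1`, the
operator `(1 + S) / √2` is a Clifford operator that acts as the symplectic transvection along the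
label of `S`. Transvections are transitive on nonzero labels (`exists_smul_eq`), so all stabilizers
of nonzero labels are conjugate, of index `4 ^ n - 1`.

*The subgroup `IN` is the stabilizer of `Y₁`.* Its generators fix `Y₁` up to phases. The subgroup
`IN` maps `Z₁` to every Pauli operator that anticommutes with `Y₁` (`exists_mem_IN_smul_eq`), and
there are `2 ^ (2 * n - 1)` of these modulo phases. An operator that fixes both `Y₁` and `Z₁` up to
phases has the form `P ⊗ A`, where `P` is a one-qubit Pauli operator and `A` is a Clifford operator
on the other qubits (`exists_eq_pauliCls_mul_projIdTensor`); such operators lie in `IN`, and there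
are `4 * |𝒞ₙ₋₁|` of them modulo phases (`fixFirstQubitEquiv`). This gives both the equality
(`IN_eq_stabilizer`) and the order (`card_stabilizer_labelY`). The same count bounds `𝒞ₙ` in terms
of `𝒞ₙ₋₁`, so that projective Clifford groups are finite by induction (`finite_projCliff`).
-/

noncomputable section

namespace Qubits

/-! ### One-qubit Pauli operators -/

/-- The label `(a, b)` of the one-qubit Pauli operator `X ^ a * Z ^ b`. -/
abbrev Label₁ : Type := ZMod 2 × ZMod 2

/-- The one-qubit Pauli operator `X ^ a.1 * Z ^ a.2`. -/
def pauliGate (a : Label₁) : U₁ := X ^ a.1.val * Z ^ a.2.val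

/-- The commutation sign of two one-qubit Pauli operators. -/
def sign₁ (a b : Label₁) : ℤˣ := if a.1 * b.2 + a.2 * b.1 = 0 then 1 else -1

theorem sign₁_add_left : ∀ a b c : Label₁, sign₁ (a + b) c = sign₁ a c * sign₁ b c := by decide

theorem sign₁_comm : ∀ a b : Label₁, sign₁ a b = sign₁ b a := by decide

theorem sign₁_self : ∀ a : Label₁, sign₁ a a = 1 := by decide

theorem sign₁_nondegenerate : ∀ a : Label₁, (∀ b, sign₁ a b = 1) → a = 0 := by decide

/-- The pairing `sign₁` identifies `Label₁` with its group of `±1`-valued characters. -/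
theorem exists_sign₁_eq (f : Label₁ → ℤˣ) (hf : ∀ a b, f (a + b) = f a * f b) :
    ∃ r, ∀ a, f a = sign₁ r a := by
  have key : ∀ u v : ℤˣ, ∃ r, sign₁ r (1, 0) = u ∧ sign₁ r (0, 1) = v := by decide
  obtain ⟨r, h1, h2⟩ := key (f (1, 0)) (f (0, 1))
  have hadd : ∀ a b, sign₁ r (a + b) = sign₁ r a * sign₁ r b := fun a b => by
    rw [sign₁_comm, sign₁_add_left, sign₁_comm a, sign₁_comm b]
  have h0 : f 0 = 1 := by simpa using hf 0 0
  have h3 : f (1, 1) = f (1, 0) * f (0, 1) := by rw [← hf]; rfl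
  have h4 : sign₁ r (1, 1) = sign₁ r (1, 0) * sign₁ r (0, 1) := by rw [← hadd]; rfl
  have h5 : sign₁ r 0 = 1 := by simpa using hadd 0 0
  refine ⟨r, fun a => ?_⟩
  have hcases : ∀ a : Label₁, a = 0 ∨ a = (1, 0) ∨ a = (0, 1) ∨ a = (1, 1) := by decide
  rcases hcases a with rfl | rfl | rfl | rfl
  · rw [h0, h5]
  · exact h1.symm
  · exact h2.symm
  · rw [h3, h4, h1, h2]

theorem iI_pow_val (k : ℕ) : (iI ^ k).1 = Complex.I ^ k • (1 : Matrix (Fin 2) (Fin 2) ℂ) := by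
  have h : iI.1 = Complex.I • (1 : Matrix (Fin 2) (Fin 2) ℂ) := by
    rw [← Matrix.ext_iff]
    simp [Fin.forall_fin_two, iI]
  change iI.1 ^ k = _
  rw [h, smul_pow, one_pow]

theorem pauliGate_val (a : Label₁) :
    (pauliGate a).1 = !![0, 1; 1, 0] ^ a.1.val * !![1, 0; 0, -1] ^ a.2.val := rfl

theorem pauliGate_mul_comm (a b : Label₁) : (pauliGate a).1 * (pauliGate b).1 =
    ((sign₁ a b : ℤ) : ℂ) • ((pauliGate b).1 * (pauliGate a).1) := by
  obtain ⟨a1, a2⟩ := a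
  obtain ⟨b1, b2⟩ := b
  have hcases : ∀ c : ZMod 2, c = 0 ∨ c = 1 := by decide
  have h1 : (1 : ZMod 2).val = 1 := rfl
  have h11 : (1 : ZMod 2) + 1 = 0 := rfl
  rw [← Matrix.ext_iff]
  rcases hcases a1 with rfl | rfl <;> rcases hcases a2 with rfl | rfl <;>
    rcases hcases b1 with rfl | rfl <;> rcases hcases b2 with rfl | rfl <;>
    simp [pauliGate_val, sign₁, h1, h11, Fin.forall_fin_two]

/-- The phase in a product of two operators `X ^ a * Z ^ b` is a sign, so the exponent is even. -/
theorem pauliGate_mul (a b : Label₁) :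
    ∃ k : ℕ, pauliGate a * pauliGate b = iI ^ (2 * k) * pauliGate (a + b) := by
  have key : ∃ k : ℕ, (pauliGate a).1 * (pauliGate b).1 =
      Complex.I ^ (2 * k) • (pauliGate (a + b)).1 := by
    obtain ⟨a1, a2⟩ := a
    obtain ⟨b1, b2⟩ := b
    have hcases : ∀ c : ZMod 2, c = 0 ∨ c = 1 := by decide
    have h1 : (1 : ZMod 2).val = 1 := rfl
    have h11 : (1 : ZMod 2) + 1 = 0 := rfl
    refine ⟨a2.val * b1.val, ?_⟩
    rw [pow_mul, Complex.I_sq, ← Matrix.ext_iff]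
    rcases hcases a1 with rfl | rfl <;> rcases hcases a2 with rfl | rfl <;>
      rcases hcases b1 with rfl | rfl <;> rcases hcases b2 with rfl | rfl <;>
      simp [pauliGate_val, h1, h11, Fin.forall_fin_two]
  obtain ⟨k, hk⟩ := key
  refine ⟨k, Subtype.ext ?_⟩
  change (pauliGate a).1 * (pauliGate b).1 = (iI ^ (2 * k)).1 * (pauliGate (a + b)).1
  rw [hk, iI_pow_val, smul_mul_assoc, one_mul]

theorem iI_pow_mul_comm (k : ℕ) (A : U₁) : iI ^ k * A = A * iI ^ k := by
  apply Subtype.ext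
  change (iI ^ k).1 * A.1 = A.1 * (iI ^ k).1
  rw [iI_pow_val, smul_mul_assoc, one_mul, mul_smul_comm, mul_one]

theorem pauliGate_mem (a : Label₁) : pauliGate a ∈ pauliOne :=
  mul_mem (pow_mem X_mem _) (pow_mem Z_mem _)

theorem pauliGate_zero : pauliGate 0 = 1 := by simp [pauliGate]

/-- Up to a power of `i`, every element of the one-qubit Pauli group is some `pauliGate a`. -/
theorem exists_of_mem_pauliOne {A : U₁} (hA : A ∈ pauliOne) :
    ∃ (k : ℕ) (a : Label₁), A = iI ^ k * pauliGate a := by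
  have h1 : (1 : ZMod 2).val = 1 := rfl
  have h4 : iI ^ 4 = 1 := by
    apply Subtype.ext
    rw [iI_pow_val, Complex.I_pow_four, one_smul]
    rfl
  have hmul : ∀ A B : U₁, (∃ (k : ℕ) (a : Label₁), A = iI ^ k * pauliGate a) →
      (∃ (k : ℕ) (a : Label₁), B = iI ^ k * pauliGate a) →
      ∃ (k : ℕ) (a : Label₁), A * B = iI ^ k * pauliGate a := by
    rintro _ _ ⟨k, a, rfl⟩ ⟨l, b, rfl⟩
    obtain ⟨m, hm⟩ := pauliGate_mul a b
    refine ⟨k + l + 2 * m, a + b, ?_⟩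
    rw [mul_assoc, ← mul_assoc (pauliGate a), ← iI_pow_mul_comm, mul_assoc, hm, pow_add, pow_add]
    simp only [mul_assoc]
  refine Subgroup.closure_induction (p := fun A _ => ∃ (k : ℕ) (a : Label₁),
    A = iI ^ k * pauliGate a) ?_ ?_ ?_ ?_ hA
  · rintro A (rfl | rfl | rfl)
    · exact ⟨0, (1, 0), by simp [pauliGate, h1]⟩
    · exact ⟨0, (0, 1), by simp [pauliGate, h1]⟩
    · exact ⟨1, 0, by simp [pauliGate]⟩
  · exact ⟨0, 0, by simp [pauliGate]⟩
  · intro A B _ _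
    exact hmul A B
  · rintro _ - ⟨k, a, rfl⟩
    obtain ⟨l, hl⟩ := pauliGate_mul a a
    have haa : a + a = 0 := CharTwo.add_self_eq_zero a
    rw [haa, pauliGate_zero, mul_one] at hl
    refine ⟨3 * (k + 2 * l), a, inv_eq_of_mul_eq_one_left ?_⟩
    rw [mul_assoc, ← mul_assoc (pauliGate a), ← iI_pow_mul_comm, mul_assoc, hl, ← pow_add,
      ← pow_add, show 3 * (k + 2 * l) + (k + 2 * l) = 4 * (k + 2 * l) by ring, pow_mul, h4, one_pow]

/-! ### Pauli operators on several qubits -/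

/-- Labels of `n`-qubit Pauli operators modulo phases: the vector space `𝔽₂²ⁿ`. -/
abbrev Label (n : ℕ) : Type := Fin n → Label₁

/-- The `n`-qubit Pauli operator with label `a`. -/
def pauliOp {n : ℕ} (a : Label n) : U n := tensor n fun i => pauliGate (a i)

/-- The commutation sign of two Pauli operators. In multiplicative notation this is the standard
symplectic form on `𝔽₂²ⁿ`. -/
def sign {n : ℕ} (a b : Label n) : ℤˣ := ∏ i, sign₁ (a i) (b i)

section sign

variable {n : ℕ}

theorem sign_comm (a b : Label n) : sign a b = sign b a :=
  Finset.prod_congr rfl fun _ _ => sign₁_comm _ _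

theorem sign_add_left (a b c : Label n) : sign (a + b) c = sign a c * sign b c := by
  simp only [sign, Pi.add_apply, sign₁_add_left, Finset.prod_mul_distrib]

theorem sign_add_right (a b c : Label n) : sign a (b + c) = sign a b * sign a c := by
  rw [sign_comm, sign_add_left, sign_comm b, sign_comm c]

theorem sign_self (a : Label n) : sign a a = 1 :=
  Finset.prod_eq_one fun _ _ => sign₁_self _

theorem sign₁_zero_right (a : Label₁) : sign₁ a 0 = 1 := by simp [sign₁]

theorem sign_single (a : Label n) (i : Fin n) (b : Label₁) :
    sign a (Pi.single i b) = sign₁ (a i) b := by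
  rw [sign, Finset.prod_eq_single i]
  · simp
  · intro j _ hj
    simp [hj, sign₁_zero_right]
  · simp

theorem sign_nondegenerate {a : Label n} (h : ∀ b, sign a b = 1) : a = 0 := by
  funext i
  exact sign₁_nondegenerate _ fun b => by rw [← sign_single]; exact h _

theorem label_add_self (a : Label n) : a + a = 0 :=
  funext fun i => CharTwo.add_self_eq_zero (a i)

theorem eq_of_sign_eq {a b : Label n} (h : ∀ c, sign a c = sign b c) : a = b := by
  have h0 : a + b = 0 := sign_nondegenerate fun c => by
    rw [sign_add_left, h, Int.units_mul_self]
  rw [← add_zero a, ← label_add_self b, ← add_assoc, h0, zero_add]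

theorem exists_sign_eq_neg_one {a : Label n} (h : a ≠ 0) : ∃ b, sign a b = -1 := by
  by_contra! hb
  exact h (sign_nondegenerate fun b => (Int.units_eq_one_or _).resolve_right (hb b))

/-- The pairing `sign` identifies `Label n` with its group of `±1`-valued characters. -/
theorem exists_sign_eq (f : Label n → ℤˣ) (hf : ∀ a b, f (a + b) = f a * f b) :
    ∃ r, ∀ a, f a = sign r a := by
  have h0 : f 0 = 1 := by simpa using hf 0 0
  have hi : ∀ i, ∃ r, ∀ b, f (Pi.single i b) = sign₁ r b := fun i =>
    exists_sign₁_eq (fun b => f (Pi.single i b)) fun b c => by rw [Pi.single_add, hf]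
  choose r hr using hi
  refine ⟨r, fun a => ?_⟩
  have hsum : ∀ s : Finset (Fin n), f (∑ i ∈ s, Pi.single i (a i)) = ∏ i ∈ s, sign₁ (r i) (a i) := by
    intro s
    induction s using Finset.induction_on with
    | empty => simpa using h0
    | insert i s hi ih => rw [Finset.sum_insert hi, Finset.prod_insert hi, hf, ih, hr]
  rw [sign, ← hsum, Finset.univ_sum_single]

end sign

theorem tensorMatrix_smul {n : ℕ} (c : Fin n → ℂ) (A : Fin n → Matrix (Fin 2) (Fin 2) ℂ) :
    tensorMatrix (fun i => c i • A i) = (∏ i, c i) • tensorMatrix A := by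
  ext x y
  simp [tensorMatrix, Finset.prod_mul_distrib]

theorem pauliOp_val {n : ℕ} (a : Label n) :
    (pauliOp a).1 = tensorMatrix fun i => (pauliGate (a i)).1 := rfl

theorem pauliOp_zero {n : ℕ} : pauliOp (0 : Label n) = 1 := by
  simp only [pauliOp, Pi.zero_apply, pauliGate_zero]
  exact map_one _

theorem pauliOp_mul_comm {n : ℕ} (a b : Label n) : (pauliOp a).1 * (pauliOp b).1 =
    ((sign a b : ℤ) : ℂ) • ((pauliOp b).1 * (pauliOp a).1) := by
  simp only [pauliOp_val, ← tensorMatrix_mul, pauliGate_mul_comm (a _), sign]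
  rw [tensorMatrix_smul]
  push_cast
  rfl

theorem tensor_iI_pow_mul {n : ℕ} (k : Fin n → ℕ) (a : Label n) :
    (tensor n fun i => iI ^ k i * pauliGate (a i)).1 =
      Complex.I ^ (∑ i, k i) • (pauliOp a).1 := by
  change tensorMatrix (fun i => (iI ^ k i).1 * (pauliGate (a i)).1) = _
  simp only [iI_pow_val, smul_mul_assoc, one_mul]
  rw [tensorMatrix_smul, Finset.prod_pow_eq_pow_sum]
  rfl

theorem pauliOp_mem {n : ℕ} (a : Label n) : pauliOp a ∈ pauli n :=
  tensor_mem fun _ => pauliGate_mem _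

theorem pauliOp_mul {n : ℕ} (a b : Label n) :
    ∃ k : ℕ, (pauliOp a).1 * (pauliOp b).1 = (-1 : ℂ) ^ k • (pauliOp (a + b)).1 := by
  choose k hk using fun i => pauliGate_mul (a i) (b i)
  refine ⟨∑ i, k i, ?_⟩
  rw [← Complex.I_sq, ← pow_mul, Finset.mul_sum, ← tensor_iI_pow_mul]
  change (pauliOp a * pauliOp b).1 = _
  rw [pauliOp, pauliOp, ← map_mul]
  congr 2
  funext i
  exact hk i

theorem exists_of_mem_pauli {n : ℕ} {A : U n} (hA : A ∈ pauli n) :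
    ∃ (k : ℕ) (a : Label n), A.1 = Complex.I ^ k • (pauliOp a).1 := by
  obtain ⟨P, hP, rfl⟩ := hA
  choose k a h using fun i => exists_of_mem_pauliOne (hP i trivial)
  refine ⟨∑ i, k i, a, ?_⟩
  rw [← tensor_iI_pow_mul, funext h]

/-- The converse of `exists_of_mem_pauli`. It fails on zero qubits, where the Pauli group is
trivial. -/
theorem mem_pauli_of_eq_smul {n : ℕ} [NeZero n] {A : U n} {k : ℕ} {a : Label n}
    (h : A.1 = Complex.I ^ k • (pauliOp a).1) : A ∈ pauli n := by
  -- the whole phase is put on the first qubit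
  have h2 : A = tensor n fun i => iI ^ (Pi.single (0 : Fin n) k : Fin n → ℕ) i *
      pauliGate (a i) := by
    apply Subtype.ext
    rw [tensor_iI_pow_mul, h, Finset.sum_pi_single']
    simp
  rw [h2]
  exact tensor_mem fun i => mul_mem (pow_mem iI_mem _) (pauliGate_mem _)

theorem val_ne_zero {n : ℕ} (A : U n) : A.1 ≠ 0 := by
  intro h
  have h2 := mem_unitaryGroup_iff.1 A.2
  rw [h, zero_mul] at h2
  exact zero_ne_one h2

/-- Pauli operators with different labels are not proportional, as their commutation signs
differ. -/
theorem pauliOp_injective {n : ℕ} {a b : Label n} {c : ℂ}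
    (h : (pauliOp a).1 = c • (pauliOp b).1) : a = b := by
  refine eq_of_sign_eq fun d => ?_
  have h1 := pauliOp_mul_comm a d
  rw [h, smul_mul_assoc, pauliOp_mul_comm b d, mul_smul_comm, smul_comm] at h1
  have h2 : c • ((pauliOp d).1 * (pauliOp b).1) ≠ 0 := by
    rw [← mul_smul_comm, ← h]
    exact val_ne_zero (pauliOp d * pauliOp a)
  have h3 := smul_left_injective ℂ h2 h1
  exact (Units.ext (Int.cast_injective h3)).symm

/-! ### The projective Pauli group and the action of the projective Clifford group on labels -/

/-- Classes agree when the operators are proportional: the factor has modulus one, as both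
operators are unitary. -/
theorem cls_eq_iff {n : ℕ} {A B : Cliff n} : cls A = cls B ↔ ∃ c : ℂ, A.1.1 = c • B.1.1 := by
  rw [QuotientGroup.eq, phases, Subgroup.mem_subgroupOf, MonoidHom.mem_range]
  constructor
  · rintro ⟨z, hz⟩
    refine ⟨(z⁻¹ : Circle), ?_⟩
    have h1 : B.1 = A.1 * phase n z := by rw [hz]; simp
    have h2 : A.1 = B.1 * phase n z⁻¹ := by rw [h1, mul_assoc, ← map_mul]; simp
    have h3 := congrArg Subtype.val h2
    rw [h3]
    change B.1.1 * (((z⁻¹ : Circle) : ℂ) • 1) = _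
    rw [mul_smul_comm, mul_one]
  · rintro ⟨c, hc⟩
    have hA := mem_unitaryGroup_iff.1 A.1.2
    have hB := mem_unitaryGroup_iff.1 B.1.2
    rw [hc, star_smul, smul_mul_smul_comm, hB] at hA
    have hcc : c * star c = 1 := by
      have := congrFun (congrFun hA fun _ => 0) fun _ => 0
      simpa using this
    have hn : ‖c‖ = 1 := by
      have h1 : ‖c‖ * ‖c‖ = 1 := by
        nth_rw 2 [← norm_star c]
        rw [← norm_mul, hcc, norm_one]
      nlinarith [norm_nonneg c]
    let z : Circle := ⟨c, mem_sphere_zero_iff_norm.2 hn⟩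
    refine ⟨z⁻¹, ?_⟩
    have h1 : A.1 = B.1 * phase n z := by
      apply Subtype.ext
      change A.1.1 = B.1.1 * (c • 1)
      rw [hc, mul_smul_comm, mul_one]
    have h2 : B.1 = A.1 * phase n z⁻¹ := by rw [h1, mul_assoc, ← map_mul]; simp
    simp [h2]

theorem exists_cls_eq {n : ℕ} (g : ProjCliff n) : ∃ A : Cliff n, cls A = g :=
  QuotientGroup.mk_surjective g

/-- The Pauli operator with label `a`, as a Clifford operator. -/
def cPauli {n : ℕ} (a : Label n) : Cliff n := ⟨pauliOp a, pauli_le_Cliff n (pauliOp_mem a)⟩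

/-- The class of the Pauli operator with label `a` in the projective Clifford group. -/
def pauliCls {n : ℕ} (a : Label n) : ProjCliff n := cls (cPauli a)

theorem pauliCls_injective {n : ℕ} : Function.Injective (pauliCls (n := n)) := by
  intro a b h
  obtain ⟨c, hc⟩ := cls_eq_iff.1 h
  exact pauliOp_injective hc

theorem pauliCls_add {n : ℕ} (a b : Label n) : pauliCls (a + b) = pauliCls a * pauliCls b := by
  obtain ⟨k, hk⟩ := pauliOp_mul a b
  exact (cls_eq_iff (A := cPauli a * cPauli b) (B := cPauli (a + b)).2 ⟨_, hk⟩).symm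

theorem pauliCls_zero {n : ℕ} : pauliCls (0 : Label n) = 1 := by
  have h := pauliCls_add (0 : Label n) 0
  rw [add_zero] at h
  exact left_eq_mul.1 h

theorem pauliCls_inv {n : ℕ} (a : Label n) : (pauliCls a)⁻¹ = pauliCls a := by
  rw [inv_eq_iff_mul_eq_one, ← pauliCls_add, label_add_self, pauliCls_zero]

theorem pauliCls_mem {n : ℕ} (a : Label n) : pauliCls a ∈ projPauli n :=
  ⟨cPauli a, pauliOp_mem a, rfl⟩

theorem exists_pauliCls_eq {n : ℕ} {g : ProjCliff n} (hg : g ∈ projPauli n) :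
    ∃ a, pauliCls a = g := by
  obtain ⟨A, hA, rfl⟩ := hg
  obtain ⟨k, a, h⟩ := exists_of_mem_pauli (A := A.1) hA
  exact ⟨a, (cls_eq_iff.2 ⟨_, h⟩).symm⟩

/-- The projective Pauli group is parametrized by labels. -/
def labelEquiv (n : ℕ) : Label n ≃ projPauli n :=
  Equiv.ofBijective (fun a => ⟨pauliCls a, pauliCls_mem a⟩)
    ⟨fun _ _ h => pauliCls_injective (congrArg Subtype.val h), fun ⟨_, hg⟩ =>
      (exists_pauliCls_eq hg).imp fun _ h => Subtype.ext h⟩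

/-- The action of the projective Clifford group on labels that corresponds to conjugation of
projective Pauli operators. -/
instance (n : ℕ) : SMul (ProjCliff n) (Label n) :=
  ⟨fun g a => (labelEquiv n).symm (MulAut.conjNormal g (labelEquiv n a))⟩

instance (n : ℕ) : MulAction (ProjCliff n) (Label n) where
  one_smul a := by
    change (labelEquiv n).symm (MulAut.conjNormal 1 (labelEquiv n a)) = a
    simp
  mul_smul g h a := by
    change (labelEquiv n).symm (MulAut.conjNormal (g * h) (labelEquiv n a)) =
      (labelEquiv n).symm (MulAut.conjNormal g (labelEquiv n ((labelEquiv n).symm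
        (MulAut.conjNormal h (labelEquiv n a)))))
    simp

theorem pauliCls_smul {n : ℕ} (g : ProjCliff n) (a : Label n) :
    pauliCls (g • a) = g * pauliCls a * g⁻¹ := by
  have h : labelEquiv n (g • a) = MulAut.conjNormal g (labelEquiv n a) :=
    (labelEquiv n).apply_symm_apply _
  exact congrArg Subtype.val h

theorem smul_eq_iff {n : ℕ} {g : ProjCliff n} {a b : Label n} :
    g • a = b ↔ g * pauliCls a = pauliCls b * g := by
  rw [← pauliCls_injective.eq_iff, pauliCls_smul, mul_inv_eq_iff_eq_mul]

theorem cls_smul_eq_iff {n : ℕ} {A : Cliff n} {a b : Label n} :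
    cls A • a = b ↔ ∃ c : ℂ, A.1.1 * (pauliOp a).1 = c • ((pauliOp b).1 * A.1.1) :=
  smul_eq_iff.trans (cls_eq_iff (A := A * cPauli a) (B := cPauli b * A))

theorem cls_smul_eq {n : ℕ} {A : Cliff n} {a b : Label n}
    (h : A.1 * pauliOp a = pauliOp b * A.1) : cls A • a = b :=
  cls_smul_eq_iff.2 ⟨1, by rw [one_smul]; exact congrArg Subtype.val h⟩

theorem smul_label_add {n : ℕ} (g : ProjCliff n) (a b : Label n) :
    g • (a + b) = g • a + g • b := by
  rw [smul_eq_iff, pauliCls_add, pauliCls_add, pauliCls_smul, pauliCls_smul]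
  group

theorem smul_label_zero {n : ℕ} (g : ProjCliff n) : g • (0 : Label n) = 0 := by
  rw [smul_eq_iff, pauliCls_zero, mul_one, one_mul]

/-- Pauli operators commute up to signs, so they act trivially on labels. -/
theorem pauliCls_smul_label {n : ℕ} (a b : Label n) : pauliCls a • b = b := by
  rw [smul_eq_iff, ← pauliCls_add, ← pauliCls_add, add_comm]

/-- Clifford operators preserve commutation signs of Pauli operators. -/
theorem sign_smul_smul {n : ℕ} (g : ProjCliff n) (a b : Label n) :
    sign (g • a) (g • b) = sign a b := by
  obtain ⟨A, rfl⟩ := exists_cls_eq g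
  obtain ⟨c, hc⟩ := cls_smul_eq_iff.1 (rfl : cls A • a = _)
  obtain ⟨d, hd⟩ := cls_smul_eq_iff.1 (rfl : cls A • b = _)
  set a' := cls A • a
  set b' := cls A • b
  -- conjugating `P Q = ± Q P` by `A` produces the same scalar `c * d` on both sides
  have h1 : A.1.1 * ((pauliOp a).1 * (pauliOp b).1) =
      (c * d) • ((pauliOp a').1 * (pauliOp b').1 * A.1.1) := by
    rw [← mul_assoc, hc, smul_mul_assoc, mul_assoc, hd, mul_smul_comm, smul_smul, mul_assoc]
  have h2 : A.1.1 * ((pauliOp b).1 * (pauliOp a).1) =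
      (c * d) • ((pauliOp b').1 * (pauliOp a').1 * A.1.1) := by
    rw [← mul_assoc, hd, smul_mul_assoc, mul_assoc, hc, mul_smul_comm, smul_smul, mul_assoc,
      mul_comm c]
  rw [pauliOp_mul_comm a b, pauliOp_mul_comm a' b', mul_smul_comm, h2, smul_mul_assoc,
    smul_comm (c * d)] at h1
  have h3 : (c * d) • ((pauliOp b').1 * (pauliOp a').1 * A.1.1) ≠ 0 := by
    rw [← h2]
    exact val_ne_zero (A.1 * (pauliOp b * pauliOp a))
  have h4 := smul_left_injective ℂ h3 h1
  exact (Units.ext (Int.cast_injective h4)).symm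

/-! ### Transitivity on nontrivial Pauli operators -/

/-- Membership in the Clifford group may be tested on the operators `pauliOp a`: the remaining
Pauli operators differ from these by powers of `i`, which are central. -/
theorem mem_Cliff_of_conj {n : ℕ} [NeZero n] {A : U n}
    (h1 : ∀ a, A * pauliOp a * A⁻¹ ∈ pauli n) (h2 : ∀ a, A⁻¹ * pauliOp a * A ∈ pauli n) :
    A ∈ Cliff n := by
  have key : ∀ B : U n, (∀ a, B * pauliOp a * B⁻¹ ∈ pauli n) →
      ∀ P ∈ pauli n, B * P * B⁻¹ ∈ pauli n := by
    intro B hB P hP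
    obtain ⟨k, a, h⟩ := exists_of_mem_pauli hP
    obtain ⟨l, b, h'⟩ := exists_of_mem_pauli (hB a)
    refine mem_pauli_of_eq_smul (k := k + l) (a := b) ?_
    change B.1 * P.1 * (B⁻¹).1 = _
    rw [h, mul_smul_comm, smul_mul_assoc, pow_add, mul_smul, ← h']
    rfl
  refine Subgroup.mem_normalizer_iff.2 fun P => ⟨key A h1 P, fun hP => ?_⟩
  have h := key A⁻¹ (by simpa using h2) _ hP
  simpa [mul_assoc] using h

/-- The square root `(1 + S) / √2` of a unitary operator `S` with `S² = -1`. -/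
theorem sqrt_mem_unitary {n : ℕ} {S : Matrix (Fin n → Fin 2) (Fin n → Fin 2) ℂ}
    (hS : star S = -S) (hS2 : S * S = -1) :
    ((√2 : ℝ) : ℂ)⁻¹ • (1 + S) ∈ unitaryGroup (Fin n → Fin 2) ℂ := by
  have h : ((√2 : ℝ) : ℂ)⁻¹ * ((√2 : ℝ) : ℂ)⁻¹ = 1 / 2 := by
    rw [← mul_inv, ← Complex.ofReal_mul, Real.mul_self_sqrt (by norm_num)]
    norm_num
  have hr : star ((√2 : ℝ) : ℂ)⁻¹ = ((√2 : ℝ) : ℂ)⁻¹ := by simp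
  rw [mem_unitaryGroup_iff, star_smul, hr, smul_mul_smul_comm, h, star_add, star_one, hS]
  have h2 : (1 + S) * (1 + -S) = (2 : ℂ) • 1 := by
    have : (1 + S) * (1 + -S) = 1 - S * S := by noncomm_ring
    rw [this, hS2, two_smul, sub_neg_eq_add]
  rw [h2, smul_smul]
  norm_num

/-- A Pauli operator `P` satisfies `P² = ±1`, so that one of `P`, `i P` is skew-Hermitian with
square `-1`. -/
theorem exists_skew_multiple {n : ℕ} (a : Label n) : ∃ k : ℕ,
    star (Complex.I ^ k • (pauliOp a).1) = -(Complex.I ^ k • (pauliOp a).1) ∧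
    (Complex.I ^ k • (pauliOp a).1) * (Complex.I ^ k • (pauliOp a).1) = -1 := by
  obtain ⟨l, hl⟩ := pauliOp_mul a a
  rw [label_add_self, pauliOp_zero, UnitaryGroup.one_val] at hl
  have hu := mem_unitaryGroup_iff'.1 (pauliOp a).2
  set P := (pauliOp a).1
  have hstar : star P = (-1 : ℂ) ^ l • P := by
    have h2 : star P * (P * P) = P := by rw [← mul_assoc, hu, one_mul]
    rw [hl, mul_smul_comm, mul_one] at h2
    nth_rw 2 [← h2]
    rw [smul_smul, ← mul_pow, neg_one_mul, neg_neg, one_pow, one_smul]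
  rcases neg_one_pow_eq_or ℂ l with h | h
  · rw [h, one_smul] at hl hstar
    refine ⟨1, ?_, ?_⟩
    · rw [star_smul, hstar, pow_one, Complex.star_def, Complex.conj_I, neg_smul]
    · rw [smul_mul_smul_comm, hl, pow_one, Complex.I_mul_I, neg_smul, one_smul]
  · rw [h, neg_smul, one_smul] at hl hstar
    exact ⟨0, by simpa using hstar, by simpa using hl⟩

/-- For every Pauli operator there is a Clifford operator that acts on labels as the symplectic
transvection along its label. -/
theorem exists_transvection {n : ℕ} [NeZero n] (a : Label n) :
    ∃ g : ProjCliff n, ∀ b, sign a b = -1 → g • b = a + b := by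
  obtain ⟨k, hS, hS2⟩ := exists_skew_multiple a
  set S := Complex.I ^ k • (pauliOp a).1 with hSdef
  let T : U n := ⟨_, sqrt_mem_unitary hS hS2⟩
  have hr : ((√2 : ℝ) : ℂ)⁻¹ * ((√2 : ℝ) : ℂ)⁻¹ = 1 / 2 := by
    rw [← mul_inv, ← Complex.ofReal_mul, Real.mul_self_sqrt (by norm_num)]
    norm_num
  have hT : T.1 = ((√2 : ℝ) : ℂ)⁻¹ • (1 + S) := rfl
  have hTinv : (T⁻¹).1 = ((√2 : ℝ) : ℂ)⁻¹ • (1 - S) := by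
    change star (((√2 : ℝ) : ℂ)⁻¹ • (1 + S)) = _
    rw [star_smul, star_add, star_one, hS, sub_eq_add_neg]
    simp
  have hcomm : ∀ b, sign a b = 1 → T * pauliOp b = pauliOp b * T := by
    intro b hb
    have h := pauliOp_mul_comm a b
    rw [hb, Units.val_one, Int.cast_one, one_smul] at h
    apply Subtype.ext
    change T.1 * (pauliOp b).1 = (pauliOp b).1 * T.1
    rw [hT, hSdef, smul_mul_assoc, mul_smul_comm, add_mul, mul_add, smul_mul_assoc, mul_smul_comm,
      h, one_mul, mul_one]
  have hanti : ∀ b, sign a b = -1 → (pauliOp b).1 * S = -(S * (pauliOp b).1) := by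
    intro b hb
    have h := pauliOp_mul_comm b a
    rw [sign_comm, hb, Units.val_neg, Units.val_one, Int.cast_neg, Int.cast_one, neg_smul,
      one_smul] at h
    rw [hSdef, mul_smul_comm, smul_mul_assoc, h, smul_neg]
  have hconj : ∀ b, sign a b = -1 → (T * pauliOp b * T⁻¹).1 = S * (pauliOp b).1 := by
    intro b hb
    change T.1 * (pauliOp b).1 * (T⁻¹).1 = _
    have h : (1 + S) * (pauliOp b).1 * (1 - S) = (2 : ℂ) • (S * (pauliOp b).1) := by
      calc _ = (1 + S) * ((pauliOp b).1 - (pauliOp b).1 * S) := by noncomm_ring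
        _ = (1 + (S * S) + (2 : ℂ) • S) * (pauliOp b).1 := by
          rw [hanti b hb, two_smul]; noncomm_ring
        _ = _ := by rw [hS2, add_neg_cancel, zero_add, smul_mul_assoc]
    rw [hT, hTinv, smul_mul_assoc, smul_mul_smul_comm, hr, h, smul_smul]
    norm_num
  have hconj' : ∀ b, sign a b = -1 → (T⁻¹ * pauliOp b * T).1 = -(S * (pauliOp b).1) := by
    intro b hb
    change (T⁻¹).1 * (pauliOp b).1 * T.1 = _
    have h : (1 - S) * (pauliOp b).1 * (1 + S) = (-2 : ℂ) • (S * (pauliOp b).1) := by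
      calc _ = (1 - S) * ((pauliOp b).1 + (pauliOp b).1 * S) := by noncomm_ring
        _ = (1 + (S * S) + (-2 : ℂ) • S) * (pauliOp b).1 := by
          rw [hanti b hb, neg_smul, two_smul]; noncomm_ring
        _ = _ := by rw [hS2, add_neg_cancel, zero_add, smul_mul_assoc]
    rw [hT, hTinv, smul_mul_assoc, smul_mul_smul_comm, hr, h, smul_smul]
    norm_num
  have hprod : ∀ b, ∃ l : ℕ, S * (pauliOp b).1 = Complex.I ^ l • (pauliOp (a + b)).1 := by
    intro b
    obtain ⟨l, hl⟩ := pauliOp_mul a b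
    refine ⟨k + 2 * l, ?_⟩
    rw [hSdef, smul_mul_assoc, hl, smul_smul, pow_add, pow_mul, Complex.I_sq]
  have hmem : T ∈ Cliff n := by
    refine mem_Cliff_of_conj (fun b => ?_) fun b => ?_
    · rcases Int.units_eq_one_or (sign a b) with hb | hb
      · rw [hcomm b hb, mul_inv_cancel_right]
        exact pauliOp_mem b
      · obtain ⟨l, hl⟩ := hprod b
        exact mem_pauli_of_eq_smul ((hconj b hb).trans hl)
    · rcases Int.units_eq_one_or (sign a b) with hb | hb
      · rw [mul_assoc, ← hcomm b hb, inv_mul_cancel_left]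
        exact pauliOp_mem b
      · obtain ⟨l, hl⟩ := hprod b
        refine mem_pauli_of_eq_smul (k := l + 2) (a := a + b) ((hconj' b hb).trans ?_)
        rw [hl, pow_add, Complex.I_sq, mul_neg_one, neg_smul]
  refine ⟨cls ⟨T, hmem⟩, fun b hb => cls_smul_eq_iff.2 ?_⟩
  obtain ⟨l, hl⟩ := hprod b
  refine ⟨Complex.I ^ l, ?_⟩
  have h := congrArg (· * T.1) ((hconj b hb).trans hl)
  simp only [smul_mul_assoc] at h
  rw [← h]
  change (T * pauliOp b).1 = (T * pauliOp b * T⁻¹ * T).1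
  rw [inv_mul_cancel_right]

/-- The projective Clifford group acts transitively on nontrivial Pauli operators: anticommuting
ones are exchanged by the transvection along their product, and for any two nontrivial ones there
is a third that anticommutes with both. -/
theorem exists_smul_eq {n : ℕ} {a b : Label n} (ha : a ≠ 0) (hb : b ≠ 0) :
    ∃ g : ProjCliff n, g • a = b := by
  have : NeZero n := ⟨by rintro rfl; exact ha (Subsingleton.elim _ _)⟩
  have hanti : ∀ a b : Label n, sign a b = -1 → ∃ g : ProjCliff n, g • a = b := by
    intro a b hab
    obtain ⟨g, hg⟩ := exists_transvection (a + b)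
    refine ⟨g, ?_⟩
    rw [hg a (by rw [sign_add_left, sign_self, sign_comm, hab, one_mul]), add_right_comm,
      label_add_self, zero_add]
  obtain ⟨c, hac, hcb⟩ : ∃ c, sign a c = -1 ∧ sign c b = -1 := by
    obtain ⟨c, hc⟩ := exists_sign_eq_neg_one ha
    obtain ⟨d, hd⟩ := exists_sign_eq_neg_one hb
    rw [sign_comm] at hd
    rcases Int.units_eq_one_or (sign c b) with hcb | hcb
    · rcases Int.units_eq_one_or (sign a d) with had | had
      · exact ⟨c + d, by rw [sign_add_right, hc, had, mul_one],
          by rw [sign_add_left, hcb, hd, one_mul]⟩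
      · exact ⟨d, had, hd⟩
    · exact ⟨c, hc, hcb⟩
  obtain ⟨g, hg⟩ := hanti a c hac
  obtain ⟨h, hh⟩ := hanti c b hcb
  exact ⟨h * g, by rw [mul_smul, hg, hh]⟩

/-! ### Characters of the projective Pauli group -/

/-- An irreducible representation of the projective Pauli group is a multiple of the character
`a ↦ sign r a` for some label `r`. Finite dimensionality need not be assumed: each operator squares
to one, and its fixed space is a subrepresentation, so it is `1` or `-1`. -/
theorem exists_label_of_isIrreducible {n : ℕ} {V : Type*} [AddCommGroup V] [Module ℂ V]
    (σ : Representation ℂ (projPauli n) V) (hσ : σ.IsIrreducible) :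
    ∃ r : Label n, ∀ a, σ (labelEquiv n a) = ((sign r a : ℤ) : ℂ) • 1 := by
  have hadd : ∀ a b, σ (labelEquiv n (a + b)) = σ (labelEquiv n a) * σ (labelEquiv n b) := by
    intro a b
    rw [← map_mul]
    congr 1
    exact Subtype.ext (pauliCls_add a b)
  have h0 : σ (labelEquiv n 0) = 1 := by
    rw [← map_one σ]
    congr 1
    exact Subtype.ext pauliCls_zero
  have hV : Nontrivial (Module.End ℂ V) := by
    by_contra h
    rw [not_nontrivial_iff_subsingleton] at h
    have hsub : Subsingleton V := ⟨fun v w => by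
      rw [← Module.End.one_apply (R := ℂ) v, Subsingleton.elim (1 : Module.End ℂ V) 0,
        ← Module.End.one_apply (R := ℂ) w, Subsingleton.elim (1 : Module.End ℂ V) 0]
      rfl⟩
    refine (bot_ne_top (α := Subrepresentation σ)) ?_
    exact Subrepresentation.toSubmodule_injective (Subsingleton.elim _ _)
  have hpm : ∀ a, ∃ u : ℤˣ, σ (labelEquiv n a) = ((u : ℤ) : ℂ) • 1 := by
    intro a
    have hsq : σ (labelEquiv n a) * σ (labelEquiv n a) = 1 := by
      rw [← hadd, label_add_self, h0]
    let W : Subrepresentation σ :=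
      { toSubmodule := LinearMap.ker (σ (labelEquiv n a) - 1)
        apply_mem_toSubmodule := by
          intro g v hv
          obtain ⟨b, rfl⟩ := (labelEquiv n).surjective g
          rw [LinearMap.mem_ker] at hv ⊢
          have hc : (σ (labelEquiv n a) - 1) * σ (labelEquiv n b) =
              σ (labelEquiv n b) * (σ (labelEquiv n a) - 1) := by
            rw [sub_mul, mul_sub, ← hadd, ← hadd, add_comm, one_mul, mul_one]
          have h := LinearMap.congr_fun hc v
          rw [Module.End.mul_apply, Module.End.mul_apply, hv, map_zero] at h
          exact h }
    rcases eq_bot_or_eq_top W with hW | hW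
    · -- `σ v + v` is fixed, because the operator squares to one
      refine ⟨-1, ?_⟩
      have hker : LinearMap.ker (σ (labelEquiv n a) - 1) = ⊥ :=
        congrArg Subrepresentation.toSubmodule hW
      ext v
      have h1 : σ (labelEquiv n a) v + v ∈ LinearMap.ker (σ (labelEquiv n a) - 1) := by
        have h2 := LinearMap.congr_fun hsq v
        rw [Module.End.mul_apply, Module.End.one_apply] at h2
        rw [LinearMap.mem_ker, LinearMap.sub_apply, map_add, h2, Module.End.one_apply]
        abel
      rw [hker, Submodule.mem_bot] at h1
      simp [eq_neg_of_add_eq_zero_left h1]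
    · refine ⟨1, ?_⟩
      have hker : LinearMap.ker (σ (labelEquiv n a) - 1) = ⊤ :=
        congrArg Subrepresentation.toSubmodule hW
      rw [LinearMap.ker_eq_top, sub_eq_zero] at hker
      simp [hker]
  choose f hf using hpm
  obtain ⟨r, hr⟩ := exists_sign_eq f fun a b => by
    have h := hadd a b
    rw [hf, hf, hf, smul_mul_smul_comm, one_mul] at h
    have h2 := smul_left_injective ℂ (one_ne_zero (α := Module.End ℂ V)) h
    exact Units.ext (by exact_mod_cast h2)
  exact ⟨r, fun a => by rw [hf, hr]⟩

/-- The inertia subgroup of the character `a ↦ sign r a` is the stabilizer of `r`. -/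
theorem inertiaSubgroup_eq_stabilizer {n : ℕ} {V : Type*} [AddCommGroup V] [Module ℂ V]
    [Nontrivial V] (σ : Representation ℂ (projPauli n) V) (r : Label n)
    (hr : ∀ a, σ (labelEquiv n a) = ((sign r a : ℤ) : ℂ) • 1) :
    CliffordTheory.inertiaSubgroup (projPauli n) σ = MulAction.stabilizer (ProjCliff n) r := by
  have hconj : ∀ (g : ProjCliff n) (a : Label n),
      CliffordTheory.conjRep (projPauli n) g σ (labelEquiv n a) =
        ((sign (g • r) a : ℤ) : ℂ) • 1 := by
    intro g a
    rw [← smul_inv_smul g a, sign_smul_smul, ← hr, smul_inv_smul, CliffordTheory.conjRep_apply]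
    congr 1
    apply Subtype.ext
    change g⁻¹ * pauliCls a * g = pauliCls (g⁻¹ • a)
    rw [pauliCls_smul, inv_inv]
  ext g
  rw [MulAction.mem_stabilizer_iff]
  constructor
  · rintro ⟨e⟩
    refine eq_of_sign_eq fun a => ?_
    obtain ⟨v, hv⟩ := exists_ne (0 : V)
    have h := LinearMap.congr_fun (e.isIntertwining' (labelEquiv n a)) v
    rw [hconj, hr] at h
    simp only [LinearMap.comp_apply, LinearMap.smul_apply, Module.End.one_apply, map_smul] at h
    have hne : e.toLinearMap v ≠ 0 := fun h0 => hv (e.toLinearEquiv.map_eq_zero_iff.1 h0)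
    have h2 := smul_left_injective ℂ hne h
    exact Units.ext (by exact_mod_cast h2)
  · intro hg
    have h : CliffordTheory.conjRep (projPauli n) g σ = σ := by
      refine MonoidHom.ext fun x => ?_
      obtain ⟨a, rfl⟩ := (labelEquiv n).surjective x
      rw [hconj, hr, hg]
    change Nonempty _
    rw [h]
    exact ⟨Representation.Equiv.refl σ⟩

/-- By orbit–stabilizer, since the nonzero labels form one orbit. -/
theorem index_stabilizer {n : ℕ} {r : Label n} (hr : r ≠ 0) :
    (MulAction.stabilizer (ProjCliff n) r).index = 4 ^ n - 1 := by
  have horb : MulAction.orbit (ProjCliff n) r = {0}ᶜ := by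
    ext a
    rw [MulAction.mem_orbit_iff, Set.mem_compl_iff, Set.mem_singleton_iff]
    constructor
    · rintro ⟨g, rfl⟩ h
      refine hr (MulAction.injective g ?_)
      change g • r = g • 0
      rw [h, smul_label_zero]
    · exact exists_smul_eq hr
  rw [MulAction.index_stabilizer, horb, Set.ncard_compl, Set.ncard_singleton]
  simp

/-! ### Splitting off the first qubit -/

/-- The label of `P ⊗ Q`, for Pauli operators `P` on the first qubit and `Q` on the others. -/
def labelCons {n : ℕ} (a : Label₁) (b : Label n) : Label (n + 1) := Fin.cons a b

section cons

variable {n : ℕ}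

theorem exists_labelCons_eq (f : Label (n + 1)) : ∃ a b, labelCons a b = f :=
  ⟨f 0, Fin.tail f, Fin.cons_self_tail f⟩

theorem labelCons_injective {a a' : Label₁} {b b' : Label n}
    (h : labelCons a b = labelCons a' b') : a = a' ∧ b = b' :=
  Fin.cons_injective2 h

theorem labelCons_add (a a' : Label₁) (b b' : Label n) :
    labelCons a b + labelCons a' b' = labelCons (a + a') (b + b') := by
  funext i
  refine Fin.cases rfl (fun i => rfl) i

theorem labelCons_zero : labelCons 0 (0 : Label n) = 0 := by
  funext i
  refine Fin.cases rfl (fun i => rfl) i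

theorem sign_labelCons (a a' : Label₁) (b b' : Label n) :
    sign (labelCons a b) (labelCons a' b') = sign₁ a a' * sign b b' :=
  Fin.prod_univ_succ _

theorem sign_zero_right (a : Label n) : sign a 0 = 1 :=
  Finset.prod_eq_one fun _ _ => sign₁_zero_right _

theorem tensorSucc_apply (B : U₁) (A : U n) (x y : Fin (n + 1) → Fin 2) :
    (tensorSucc n (B, A)).1 x y = B.1 (x 0) (y 0) * A.1 (Fin.tail x) (Fin.tail y) := rfl

theorem tensorSucc_apply_cons (B : U₁) (A : U n) (i j : Fin 2) (s t : Fin n → Fin 2) :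
    (tensorSucc n (B, A)).1 (Fin.cons i s) (Fin.cons j t) = B.1 i j * A.1 s t := rfl

theorem tensor_eq_tensorSucc (P : Fin (n + 1) → U₁) :
    tensor (n + 1) P = tensorSucc n (P 0, tensor n (Fin.tail P)) := by
  apply Subtype.ext
  ext x y
  exact Fin.prod_univ_succ _

theorem pauliOp_labelCons (a : Label₁) (b : Label n) :
    pauliOp (labelCons a b) = tensorSucc n (pauliGate a, pauliOp b) :=
  tensor_eq_tensorSucc _

theorem tensorSucc_smul {A A' : U n} {B B' : U₁} {c d : ℂ} (hB : B.1 = c • B'.1)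
    (hA : A.1 = d • A'.1) : (tensorSucc n (B, A)).1 = (c * d) • (tensorSucc n (B', A')).1 := by
  ext x y
  rw [tensorSucc_apply, hA, hB]
  simp only [Matrix.smul_apply, smul_eq_mul, tensorSucc_apply]
  ring

/-- If `I ⊗ B` is proportional to a Pauli operator, then this operator has the trivial factor at
the first qubit, since `I ⊗ B` commutes with all operators on that qubit. -/
theorem eq_zero_of_id_tensor_eq {B : U n} {a : Label₁} {b : Label n} {z : ℂ}
    (h : (tensorSucc n (1, B)).1 = z • (pauliOp (labelCons a b)).1) :
    a = 0 ∧ B.1 = z • (pauliOp b).1 := by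
  have ha : a = 0 := by
    refine sign₁_nondegenerate a fun d => ?_
    have h1 : (tensorSucc n (1, B)).1 * (pauliOp (labelCons d 0)).1 =
        (pauliOp (labelCons d 0)).1 * (tensorSucc n (1, B)).1 := by
      change (tensorSucc n (1, B) * pauliOp (labelCons d 0)).1 =
        (pauliOp (labelCons d 0) * tensorSucc n (1, B)).1
      rw [pauliOp_labelCons, pauliOp_zero, ← map_mul, ← map_mul]
      simp only [Prod.mk_mul_mk, one_mul, mul_one]
    have hne := val_ne_zero (pauliOp (labelCons d 0) * tensorSucc n (1, B))
    change (pauliOp (labelCons d 0)).1 * (tensorSucc n (1, B)).1 ≠ 0 at hne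
    rw [h, smul_mul_assoc, mul_smul_comm, pauliOp_mul_comm, smul_comm, sign_labelCons,
      sign_zero_right, mul_one] at h1
    rw [h, mul_smul_comm] at hne
    nth_rw 2 [← one_smul ℂ (z • _)] at h1
    have h2 := smul_left_injective ℂ hne h1
    exact Units.val_eq_one.1 (by exact_mod_cast h2)
  refine ⟨ha, ?_⟩
  ext s t
  have h1 := congrFun (congrFun h (Fin.cons 0 s)) (Fin.cons 0 t)
  rw [ha, pauliOp_labelCons, pauliGate_zero, Matrix.smul_apply, tensorSucc_apply_cons,
    tensorSucc_apply_cons] at h1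
  simpa using h1

/-- For `n = 0` the left side holds for `B = i`, while the Pauli group on zero qubits is trivial. -/
theorem id_tensor_mem_pauli_iff [NeZero n] {B : U n} :
    tensorSucc n (1, B) ∈ pauli (n + 1) ↔ B ∈ pauli n := by
  constructor
  · intro h
    obtain ⟨k, f, hf⟩ := exists_of_mem_pauli h
    obtain ⟨a, b, rfl⟩ := exists_labelCons_eq f
    exact mem_pauli_of_eq_smul (eq_zero_of_id_tensor_eq hf).2
  · intro h
    obtain ⟨k, b, hb⟩ := exists_of_mem_pauli h
    refine mem_pauli_of_eq_smul (k := k) (a := labelCons 0 b) ?_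
    rw [pauliOp_labelCons, pauliGate_zero,
      tensorSucc_smul (c := 1) (one_smul ℂ _).symm hb, one_mul]

theorem zero_qubits_mul_comm (A B : U 0) : A * B = B * A := by
  apply Subtype.ext
  ext x y
  obtain rfl := Subsingleton.elim x y
  change (A.1 * B.1) x x = (B.1 * A.1) x x
  rw [Matrix.mul_apply, Matrix.mul_apply, Fintype.sum_subsingleton _ x,
    Fintype.sum_subsingleton _ x, mul_comm]

theorem mem_Cliff_of_id_tensor_mem {A : U n} (h : tensorSucc n (1, A) ∈ Cliff (n + 1)) :
    A ∈ Cliff n := by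
  rcases Nat.eq_zero_or_pos n with rfl | hn
  · refine Subgroup.mem_normalizer_iff.2 fun P => ?_
    rw [zero_qubits_mul_comm A, mul_inv_cancel_right]
  · have : NeZero n := ⟨hn.ne'⟩
    refine Subgroup.mem_normalizer_iff.2 fun P => ?_
    have h2 : tensorSucc n (1, A) * tensorSucc n (1, P) * (tensorSucc n (1, A))⁻¹ =
        tensorSucc n (1, A * P * A⁻¹) := by
      rw [← map_inv, ← map_mul, ← map_mul]
      simp
    rw [← id_tensor_mem_pauli_iff (B := P), ← id_tensor_mem_pauli_iff (B := A * P * A⁻¹), ← h2]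
    exact Subgroup.mem_normalizer_iff.1 h _

theorem sum_cons (f : (Fin (n + 1) → Fin 2) → ℂ) :
    ∑ x, f x = ∑ i, ∑ s, f (Fin.cons i s) := by
  rw [← (Fin.consEquiv fun _ => Fin 2).sum_comp, Fintype.sum_prod_type]
  rfl

theorem mul_tensorSucc_one (A : Matrix (Fin (n + 1) → Fin 2) (Fin (n + 1) → Fin 2) ℂ) (B : U₁)
    (x : Fin (n + 1) → Fin 2) (j : Fin 2) (t : Fin n → Fin 2) :
    (A * (tensorSucc n (B, 1)).1) x (Fin.cons j t) = ∑ i, A x (Fin.cons i t) * B.1 i j := by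
  rw [Matrix.mul_apply, sum_cons]
  simp [tensorSucc_apply_cons, Matrix.one_apply]

theorem tensorSucc_one_mul (A : Matrix (Fin (n + 1) → Fin 2) (Fin (n + 1) → Fin 2) ℂ) (B : U₁)
    (y : Fin (n + 1) → Fin 2) (i : Fin 2) (s : Fin n → Fin 2) :
    ((tensorSucc n (B, 1)).1 * A) (Fin.cons i s) y = ∑ j, B.1 i j * A (Fin.cons j s) y := by
  rw [Matrix.mul_apply, sum_cons]
  simp [tensorSucc_apply_cons, Matrix.one_apply]

/-- The commutant of the Pauli operators on the first qubit. -/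
theorem exists_eq_id_tensor {A : U (n + 1)}
    (hX : A * tensorSucc n (X, 1) = tensorSucc n (X, 1) * A)
    (hZ : A * tensorSucc n (Z, 1) = tensorSucc n (Z, 1) * A) :
    ∃ B : U n, A = tensorSucc n (1, B) := by
  -- commuting with `Z₁` makes `A` block diagonal, commuting with `X₁` makes the two blocks equal
  have hX' : ∀ i s j t, (A.1 * (tensorSucc n (X, 1)).1) (Fin.cons i s) (Fin.cons j t) =
      ((tensorSucc n (X, 1)).1 * A.1) (Fin.cons i s) (Fin.cons j t) := fun i s j t =>
    congrFun (congrFun (congrArg Subtype.val hX) _) _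
  have hZ' : ∀ i s j t, (A.1 * (tensorSucc n (Z, 1)).1) (Fin.cons i s) (Fin.cons j t) =
      ((tensorSucc n (Z, 1)).1 * A.1) (Fin.cons i s) (Fin.cons j t) := fun i s j t =>
    congrFun (congrFun (congrArg Subtype.val hZ) _) _
  simp only [mul_tensorSucc_one, tensorSucc_one_mul] at hX' hZ'
  have h01 : ∀ s t, A.1 (Fin.cons 0 s) (Fin.cons 1 t) = 0 := by
    intro s t
    have h := hZ' 0 s 1 t
    simp only [Z, Fin.sum_univ_two, Matrix.of_apply, cons_val_zero, cons_val_one, mul_zero,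
      zero_mul, zero_add, add_zero, mul_neg, mul_one, one_mul] at h
    exact CharZero.neg_eq_self_iff.1 h
  have h10 : ∀ s t, A.1 (Fin.cons 1 s) (Fin.cons 0 t) = 0 := by
    intro s t
    have h := hZ' 1 s 0 t
    simp only [Z, Fin.sum_univ_two, Matrix.of_apply, cons_val_zero, cons_val_one, mul_zero,
      zero_mul, zero_add, add_zero, neg_mul, mul_one, one_mul] at h
    exact CharZero.neg_eq_self_iff.1 h.symm
  have h11 : ∀ s t, A.1 (Fin.cons 1 s) (Fin.cons 1 t) = A.1 (Fin.cons 0 s) (Fin.cons 0 t) := by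
    intro s t
    have h := hX' 0 s 1 t
    simp only [X, Fin.sum_univ_two, Matrix.of_apply, cons_val_zero, cons_val_one, mul_zero,
      zero_mul, zero_add, add_zero, mul_one, one_mul] at h
    exact h.symm
  let B : Matrix (Fin n → Fin 2) (Fin n → Fin 2) ℂ :=
    Matrix.of fun s t => A.1 (Fin.cons 0 s) (Fin.cons 0 t)
  have hB : B ∈ unitaryGroup (Fin n → Fin 2) ℂ := by
    rw [mem_unitaryGroup_iff]
    ext s t
    have h := congrFun (congrFun (mem_unitaryGroup_iff.1 A.2) (Fin.cons 0 s)) (Fin.cons 0 t)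
    rw [Matrix.mul_apply, sum_cons, Fin.sum_univ_two] at h
    simp only [h01, zero_mul, Finset.sum_const_zero, add_zero] at h
    refine (Matrix.mul_apply.trans h).trans ?_
    simp only [Matrix.one_apply, Fin.cons_inj, true_and]
  refine ⟨⟨B, hB⟩, Subtype.ext ?_⟩
  ext x y
  rw [← Fin.cons_self_tail x, ← Fin.cons_self_tail y, tensorSucc_apply_cons]
  have hcases : ∀ i : Fin 2, i = 0 ∨ i = 1 := by decide
  rcases hcases (x 0) with hx | hx <;> rcases hcases (y 0) with hy | hy <;>
    simp [hx, hy, B, h01, h10, h11]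

end cons

/-! ### Clifford operators that fix the Pauli operators on the first qubit -/

/-- The homomorphism `[A] ↦ [I ⊗ A]`. -/
def projIdTensor (n : ℕ) : ProjCliff n →* ProjCliff (n + 1) :=
  QuotientGroup.map (phases n) (phases (n + 1))
    { toFun := idTensor
      map_one' := Subtype.ext (map_one (tensorSucc n))
      map_mul' := fun A B => Subtype.ext (by
        change tensorSucc n (1, A.1 * B.1) = tensorSucc n (1, A.1) * tensorSucc n (1, B.1)
        rw [← map_mul, Prod.mk_mul_mk, one_mul]) } <| by
    intro A hA
    have hA1 : cls A = cls 1 := (QuotientGroup.eq_one_iff A).2 hA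
    obtain ⟨c, hc⟩ := cls_eq_iff.1 hA1
    refine (QuotientGroup.eq_one_iff (idTensor A)).1 (cls_eq_iff (B := 1).2 ⟨c, ?_⟩)
    change (tensorSucc n (1, A.1)).1 = c • (1 : U (n + 1)).1
    rw [tensorSucc_smul (c := 1) (one_smul ℂ _).symm hc, one_mul]
    exact congrArg (fun B : U (n + 1) => c • B.1) (map_one (tensorSucc n))

variable {n : ℕ}

theorem projIdTensor_cls (A : Cliff n) : projIdTensor n (cls A) = cls (idTensor A) := rfl

theorem projIdTensor_smul (g : ProjCliff n) (a : Label₁) (b : Label n) :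
    projIdTensor n g • labelCons a b = labelCons a (g • b) := by
  obtain ⟨A, rfl⟩ := exists_cls_eq g
  obtain ⟨c, hc⟩ := cls_smul_eq_iff.1 (rfl : cls A • b = _)
  have hc' : (A.1 * pauliOp b).1 = c • (pauliOp (cls A • b) * A.1).1 := hc
  refine cls_smul_eq_iff.2 ⟨c, ?_⟩
  change (tensorSucc n (1, A.1) * pauliOp (labelCons a b)).1 =
    c • (pauliOp (labelCons a (cls A • b)) * tensorSucc n (1, A.1)).1
  rw [pauliOp_labelCons, pauliOp_labelCons, ← map_mul, ← map_mul, Prod.mk_mul_mk, Prod.mk_mul_mk,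
    one_mul, mul_one, tensorSucc_smul (c := 1) (one_smul ℂ _).symm hc', one_mul]

/-- A Clifford operator that maps a Pauli operator to a multiple of itself commutes or anticommutes
with it. -/
theorem exists_units_of_smul_eq {A : Cliff n} {a : Label n} (h : cls A • a = a) :
    ∃ u : ℤˣ, A.1.1 * (pauliOp a).1 = ((u : ℤ) : ℂ) • ((pauliOp a).1 * A.1.1) := by
  obtain ⟨c, hc⟩ := cls_smul_eq_iff.1 h
  obtain ⟨l, hl⟩ := pauliOp_mul a a
  rw [label_add_self, pauliOp_zero, UnitaryGroup.one_val] at hl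
  have h1 : A.1.1 * ((pauliOp a).1 * (pauliOp a).1) =
      (c * c) • ((pauliOp a).1 * (pauliOp a).1 * A.1.1) := by
    rw [← mul_assoc, hc, smul_mul_assoc, mul_assoc, hc, mul_smul_comm, smul_smul, mul_assoc]
  rw [hl, mul_smul_comm, mul_one, smul_mul_assoc, one_mul] at h1
  have hne : (-1 : ℂ) ^ l • A.1.1 ≠ 0 :=
    smul_ne_zero (pow_ne_zero _ (by norm_num)) (val_ne_zero A.1)
  nth_rw 1 [← one_smul ℂ ((-1 : ℂ) ^ l • A.1.1)] at h1
  rcases mul_self_eq_one_iff.1 (smul_left_injective ℂ hne h1).symm with rfl | rfl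
  · exact ⟨1, by simpa using hc⟩
  · exact ⟨-1, by simpa using hc⟩

theorem pauliGate_X : pauliGate (1, 0) = X := by
  have h1 : (1 : ZMod 2).val = 1 := rfl
  simp [pauliGate, h1]

theorem pauliGate_Z : pauliGate (0, 1) = Z := by
  have h1 : (1 : ZMod 2).val = 1 := rfl
  simp [pauliGate, h1]

/-- A Clifford operator that fixes `X₁` and `Z₁` up to signs is `P ⊗ A` with a Pauli operator `P`
that accounts for the signs. -/
theorem exists_eq_pauliCls_mul_projIdTensor {g : ProjCliff (n + 1)}
    (hX : g • labelCons (1, 0) (0 : Label n) = labelCons (1, 0) 0)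
    (hZ : g • labelCons (0, 1) (0 : Label n) = labelCons (0, 1) 0) :
    ∃ a h, g = pauliCls (labelCons a 0) * projIdTensor n h := by
  obtain ⟨A, rfl⟩ := exists_cls_eq g
  obtain ⟨u, hu⟩ := exists_units_of_smul_eq hX
  obtain ⟨v, hv⟩ := exists_units_of_smul_eq hZ
  have key : ∀ u v : ℤˣ, ∃ a, sign₁ a (1, 0) = u ∧ sign₁ a (0, 1) = v := by decide
  obtain ⟨a, hau, hav⟩ := key u v
  have hcomm : ∀ (d : Label₁) (w : ℤˣ), sign₁ a d = w →
      A.1.1 * (pauliOp (labelCons d (0 : Label n))).1 =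
        ((w : ℤ) : ℂ) • ((pauliOp (labelCons d (0 : Label n))).1 * A.1.1) →
      pauliOp (labelCons a 0) * A.1 * tensorSucc n (pauliGate d, 1) =
        tensorSucc n (pauliGate d, 1) * (pauliOp (labelCons a 0) * A.1) := by
    intro d w hd hw
    have hp := pauliOp_mul_comm (labelCons a (0 : Label n)) (labelCons d 0)
    rw [sign_labelCons, sign_zero_right, mul_one, hd] at hp
    rw [← pauliOp_zero (n := n), ← pauliOp_labelCons]
    apply Subtype.ext
    change (pauliOp (labelCons a 0)).1 * A.1.1 * (pauliOp (labelCons d 0)).1 =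
      (pauliOp (labelCons d 0)).1 * ((pauliOp (labelCons a 0)).1 * A.1.1)
    rw [mul_assoc, hw, mul_smul_comm, ← mul_assoc, hp, smul_mul_assoc, smul_smul, mul_assoc]
    rcases Int.units_eq_one_or w with rfl | rfl <;> simp
  have h1 := hcomm _ _ hau hu
  have h2 := hcomm _ _ hav hv
  rw [pauliGate_X] at h1
  rw [pauliGate_Z] at h2
  obtain ⟨B, hB⟩ := exists_eq_id_tensor h1 h2
  have hBmem : B ∈ Cliff n := by
    refine mem_Cliff_of_id_tensor_mem ?_
    rw [← hB]
    exact (cPauli (labelCons a 0) * A).2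
  refine ⟨a, cls ⟨B, hBmem⟩, ?_⟩
  have h3 : cls (cPauli (labelCons a 0)) * cls A = cls (idTensor ⟨B, hBmem⟩) := by
    change cls (cPauli (labelCons a 0) * A) = _
    exact congrArg cls (Subtype.ext hB)
  rw [projIdTensor_cls, ← h3]
  change cls A = pauliCls (labelCons a 0) * (pauliCls (labelCons a 0) * cls A)
  nth_rw 1 [← pauliCls_inv]
  rw [inv_mul_cancel_left]

theorem pauliCls_mul_projIdTensor_injective : Function.Injective
    fun p : Label₁ × ProjCliff n => pauliCls (labelCons p.1 (0 : Label n)) * projIdTensor n p.2 := by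
  rintro ⟨a, g⟩ ⟨a', g'⟩ h
  have h1 : projIdTensor n (g * g'⁻¹) = pauliCls (labelCons (a + a') (0 : Label n)) := by
    simp only at h
    rw [map_mul, map_inv, ← add_zero (0 : Label n), ← labelCons_add, pauliCls_add,
      ← pauliCls_inv (labelCons a _), eq_inv_mul_iff_mul_eq, ← mul_assoc, h,
      mul_inv_cancel_right]
  obtain ⟨A, hA⟩ := exists_cls_eq (g * g'⁻¹)
  rw [← hA, projIdTensor_cls] at h1
  obtain ⟨z, hz⟩ := cls_eq_iff.1 h1
  obtain ⟨h2, h3⟩ := eq_zero_of_id_tensor_eq hz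
  have h4 : cls A = 1 := by
    refine cls_eq_iff (B := 1).2 ⟨z, ?_⟩
    rw [h3, pauliOp_zero]
    rfl
  have h5 : a = a' := CharTwo.add_eq_zero.1 h2
  rw [hA, mul_inv_eq_one] at h4
  rw [h5, h4]

/-- The elements of the projective Clifford group that fix `X₁` and `Z₁` up to phases are counted
by the four Pauli operators on the first qubit and the Clifford operators on the others. -/
def fixFirstQubitEquiv (n : ℕ) : Label₁ × ProjCliff n ≃
    {g : ProjCliff (n + 1) // g • labelCons (1, 0) (0 : Label n) = labelCons (1, 0) 0 ∧
      g • labelCons (0, 1) (0 : Label n) = labelCons (0, 1) 0} :=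
  Equiv.ofBijective (fun p => ⟨pauliCls (labelCons p.1 0) * projIdTensor n p.2, by
      simp only [mul_smul, projIdTensor_smul, smul_label_zero, pauliCls_smul_label, and_self]⟩)
    ⟨fun _ _ h => pauliCls_mul_projIdTensor_injective (congrArg Subtype.val h), fun ⟨g, hX, hZ⟩ =>
      let ⟨a, h, e⟩ := exists_eq_pauliCls_mul_projIdTensor hX hZ
      ⟨(a, h), Subtype.ext e.symm⟩⟩

/-- The elements that fix `X₁` and `Z₁` up to phases form a subgroup of finite index, and they are
counted in terms of one qubit less. -/
theorem finite_projCliff (n : ℕ) : Finite (ProjCliff n) := by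
  induction n with
  | zero =>
    have : Subsingleton (ProjCliff 0) := by
      refine ⟨fun g h => ?_⟩
      obtain ⟨A, rfl⟩ := exists_cls_eq g
      obtain ⟨B, rfl⟩ := exists_cls_eq h
      have hentry : ∀ C : U 0, C.1 = C.1 default default • 1 := by
        intro C
        ext x y
        obtain rfl := Subsingleton.elim default x
        obtain rfl := Subsingleton.elim default y
        simp
      have hne : B.1.1 default default ≠ 0 := by
        intro h0
        refine val_ne_zero B.1 ?_
        rw [hentry B.1, h0, zero_smul]
      refine cls_eq_iff.2 ⟨A.1.1 default default / B.1.1 default default, ?_⟩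
      refine (hentry A.1).trans ?_
      nth_rw 2 [hentry B.1]
      rw [smul_smul, div_mul_cancel₀ _ hne]
    infer_instance
  | succ n ih =>
    have hindex : ∀ a : Label (n + 1),
        (MulAction.stabilizer (ProjCliff (n + 1)) a).index ≠ 0 := by
      intro a
      rw [MulAction.index_stabilizer, Ne, Set.ncard_eq_zero]
      exact (MulAction.nonempty_orbit a).ne_empty
    let S := MulAction.stabilizer (ProjCliff (n + 1)) (labelCons (1, 0) (0 : Label n)) ⊓
      MulAction.stabilizer (ProjCliff (n + 1)) (labelCons (0, 1) (0 : Label n))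
    have hfin : Finite S := Finite.of_equiv _ (fixFirstQubitEquiv n)
    have hS : S.index ≠ 0 := Subgroup.index_inf_ne_zero (hindex _) (hindex _)
    refine Nat.finite_of_card_ne_zero ?_
    rw [← S.card_mul_index]
    exact mul_ne_zero Nat.card_pos.ne' hS

/-! ### The action of the gates `H₁`, `CX` and `M` on labels -/

/-- The label of `Y₁`, that is, of `X₁ * Z₁` up to a phase. -/
def labelY (n : ℕ) : Label (n + 1) := labelCons (1, 1) 0

theorem labelY_ne_zero : labelY n ≠ 0 := by
  rw [← labelCons_zero]
  intro h
  exact absurd (labelCons_injective h).1 (by decide)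

theorem onQubit_pauliGate (j : Fin n) (a : Label₁) :
    onQubit j (pauliGate a) = pauliOp (Pi.single j a) := by
  rw [onQubit, pauliOp]
  congr 1
  funext i
  rcases eq_or_ne i j with rfl | h
  · simp
  · simp [h, pauliGate_zero]

theorem cls_cX (j : Fin n) : cls (cX j) = pauliCls (Pi.single j (1, 0)) := by
  refine congrArg cls (Subtype.ext ?_)
  change onQubit j X = pauliOp _
  rw [← onQubit_pauliGate, pauliGate_X]

theorem cls_cZ (j : Fin n) : cls (cZ j) = pauliCls (Pi.single j (0, 1)) := by
  refine congrArg cls (Subtype.ext ?_)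
  change onQubit j Z = pauliOp _
  rw [← onQubit_pauliGate, pauliGate_Z]

theorem single_zero_eq_labelCons (a : Label₁) :
    (Pi.single 0 a : Label (n + 1)) = labelCons a 0 := by
  funext i
  refine Fin.cases ?_ (fun i => ?_) i
  · simp [labelCons]
  · simp [labelCons, Fin.succ_ne_zero]

/-- The Hadamard gate exchanges `X` and `Z` up to phases. -/
theorem H_mul_pauliGate (a : Label₁) :
    ∃ c : ℂ, H.1 * (pauliGate a).1 = c • ((pauliGate a.swap).1 * H.1) := by
  have hcases : ∀ a : Label₁, a = 0 ∨ a = (1, 0) ∨ a = (0, 1) ∨ a = (1, 1) := by decide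
  rcases hcases a with rfl | rfl | rfl | rfl
  · exact ⟨1, by simp [pauliGate]⟩
  · refine ⟨1, ?_⟩
    rw [Prod.swap_prod_mk, pauliGate_X, pauliGate_Z, one_smul]
    exact congrArg Subtype.val H_mul_X
  · refine ⟨1, ?_⟩
    rw [Prod.swap_prod_mk, pauliGate_X, pauliGate_Z, one_smul]
    exact congrArg Subtype.val H_mul_Z
  · -- `H (X Z) = (Z X) H` and `Z X = -X Z`
    refine ⟨-1, ?_⟩
    have h := pauliGate_mul_comm (0, 1) (1, 0)
    have h1 : pauliGate (1, 1) = X * Z := by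
      have h1 : (1 : ZMod 2).val = 1 := rfl
      simp [pauliGate, h1]
    have hs : sign₁ (0, 1) (1, 0) = -1 := by decide
    rw [hs, pauliGate_X, pauliGate_Z] at h
    have h2 : H.1 * (X.1 * Z.1) = Z.1 * X.1 * H.1 := by
      change (H * (X * Z)).1 = (Z * X * H).1
      rw [← mul_assoc, H_mul_X, mul_assoc, H_mul_Z, mul_assoc]
    rw [Prod.swap_prod_mk, h1]
    change H.1 * (X.1 * Z.1) = (-1 : ℂ) • (X.1 * Z.1 * H.1)
    rw [h2, h, smul_mul_assoc]
    simp

theorem cls_cH_smul (a : Label₁) (b : Label n) :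
    cls (cH (n := n + 1) 0) • labelCons a b = labelCons a.swap b := by
  obtain ⟨c, hc⟩ := H_mul_pauliGate a
  have hc' : (H * pauliGate a).1 = c • (pauliGate a.swap * H).1 := hc
  have hH : onQubit (0 : Fin (n + 1)) H = tensorSucc n (H, 1) := by
    have htail : Fin.tail (Pi.mulSingle 0 H : Fin (n + 1) → U₁) = 1 := by
      funext i
      simp [Fin.tail, Fin.succ_ne_zero]
    rw [onQubit, tensor_eq_tensorSucc, htail, map_one, Pi.mulSingle_eq_same]
  refine cls_smul_eq_iff.2 ⟨c, ?_⟩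
  change (onQubit 0 H * pauliOp (labelCons a b)).1 =
    c • (pauliOp (labelCons a.swap b) * onQubit 0 H).1
  rw [hH, pauliOp_labelCons, pauliOp_labelCons, ← map_mul, ← map_mul, Prod.mk_mul_mk,
    Prod.mk_mul_mk, one_mul, mul_one, tensorSucc_smul (d := 1) hc' (one_smul ℂ _).symm, mul_one]

theorem cls_cCX_smul {c t : Fin n} (h : c ≠ t) {a b : Label n}
    (hab : ∀ i, i ≠ c → i ≠ t → a i = b i)
    (hct : ∀ x y x' y' : Fin 2, (pauliGate (a c)).1 x x' * (pauliGate (a t)).1 (y + x) (y' + x') =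
      (pauliGate (b c)).1 x x' * (pauliGate (b t)).1 y y') :
    cls (cCX c t h) • a = b := by
  refine cls_smul_eq ?_
  change CX c t h * pauliOp a = pauliOp b * CX c t h
  rw [← mul_inv_eq_iff_eq_mul]
  exact CX_conj_tensor c t h _ _ (fun i hc ht => congrArg pauliGate (hab i hc ht)) hct

theorem cls_cCX_smul_Z : cls (cCX (n := n + 2) 0 1 Fin.zero_ne_one) •
    (labelCons (0, 1) 0 : Label (n + 2)) = labelCons (0, 1) 0 := by
  refine cls_cCX_smul _ (fun _ _ _ => rfl) ?_
  change ∀ x y x' y' : Fin 2, (pauliGate (0, 1)).1 x x' * (pauliGate 0).1 (y + x) (y' + x') =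
    (pauliGate (0, 1)).1 x x' * (pauliGate 0).1 y y'
  rw [pauliGate_Z, pauliGate_zero]
  simp [Fin.forall_fin_two, Z, Matrix.one_apply]

/-- A controlled NOT whose control carries `X` or `Y` spreads a factor `X` to the target. -/
theorem cls_cCX_smul_XY (e : ZMod 2) : cls (cCX (n := n + 2) 0 1 Fin.zero_ne_one) •
    (labelCons (1, e) 0 : Label (n + 2)) = labelCons (1, e) (labelCons (1, 0) 0) := by
  have hval : ∀ x x' : Fin 2, (pauliGate (1, e)).1 x x' =
      if x = x' then 0 else (Z.1 ^ e.val) x' x' := by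
    have hcases : ∀ c : ZMod 2, c = 0 ∨ c = 1 := by decide
    have h1 : (1 : ZMod 2).val = 1 := rfl
    rcases hcases e with rfl | rfl <;>
      simp [Fin.forall_fin_two, pauliGate_val, h1, Z]
  refine cls_cCX_smul _ ?_ ?_
  · intro i h0 h1
    obtain ⟨j, rfl⟩ := Fin.exists_succ_eq.2 h0
    have hj : j ≠ 0 := by
      rintro rfl
      exact h1 rfl
    obtain ⟨k, rfl⟩ := Fin.exists_succ_eq.2 hj
    rfl
  · change ∀ x y x' y' : Fin 2, (pauliGate (1, e)).1 x x' * (pauliGate 0).1 (y + x) (y' + x') =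
      (pauliGate (1, e)).1 x x' * (pauliGate (1, 0)).1 y y'
    rw [pauliGate_X, pauliGate_zero]
    simp [Fin.forall_fin_two, X, hval, Matrix.one_apply]

/-- The Pauli factors of `M` do not contribute to its action on labels. -/
theorem cls_M_smul (a : Label (n + 2)) : cls (M n) • a =
    cls (cCX (n := n + 2) 0 1 Fin.zero_ne_one) • cls (cH (n := n + 2) 0) • cls (cCX (n := n + 2) 0 1 Fin.zero_ne_one) • a := by
  have h : cls (M n) = cls (cCX (n := n + 2) 0 1 Fin.zero_ne_one) * (cls (cZ 0) * cls (cH 0) * cls (cX 1)) *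
    cls (cCX (n := n + 2) 0 1 Fin.zero_ne_one) := rfl
  rw [h, cls_cX, cls_cZ]
  simp only [mul_smul, pauliCls_smul_label]

theorem cls_cCX_smul_smul (a : Label (n + 2)) :
    cls (cCX (n := n + 2) 0 1 Fin.zero_ne_one) • cls (cCX (n := n + 2) 0 1 Fin.zero_ne_one) • a = a := by
  have h : cls (cCX (0 : Fin (n + 2)) 1 Fin.zero_ne_one) * cls (cCX (n := n + 2) 0 1 Fin.zero_ne_one) = 1 :=
    congrArg cls (Subtype.ext (CX_mul_CX _ _ _))
  rw [← mul_smul, h, one_smul]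

theorem cls_M_smul_labelY : cls (M n) • labelY (n + 1) = labelY (n + 1) := by
  have h : cls (cH (n := n + 2) 0) • (labelCons (1, 1) (labelCons (1, 0) 0) : Label (n + 2)) =
    labelCons (1, 1) (labelCons (1, 0) 0) := cls_cH_smul _ _
  rw [cls_M_smul, labelY, cls_cCX_smul_XY, h, ← cls_cCX_smul_XY, cls_cCX_smul_smul]

theorem cls_M_smul_Z : cls (M n) • (labelCons (0, 1) 0 : Label (n + 2)) =
    labelCons (1, 0) (labelCons (1, 0) 0) := by
  rw [cls_M_smul, cls_cCX_smul_Z, cls_cH_smul, Prod.swap_prod_mk, cls_cCX_smul_XY]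

/-! ### The subgroup `IN` is the stabilizer of `Y₁` -/

theorem IN_eq_closure : IN (n + 2) = Subgroup.closure
    ({cls (M n), cls (cH 0), cls (cX 0)} ∪ Set.range fun A : Cliff (n + 1) => cls (idTensor A)) :=
  rfl

theorem cls_M_mem : cls (M n) ∈ IN (n + 2) := Subgroup.subset_closure (by simp)

theorem cls_cH_mem : cls (cH 0) ∈ IN (n + 2) := Subgroup.subset_closure (by simp)

theorem cls_cX_mem : cls (cX 0) ∈ IN (n + 2) := Subgroup.subset_closure (by simp)

theorem projIdTensor_mem (g : ProjCliff (n + 1)) : projIdTensor (n + 1) g ∈ IN (n + 2) := by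
  obtain ⟨A, rfl⟩ := exists_cls_eq g
  exact Subgroup.subset_closure (Or.inr ⟨A, rfl⟩)

theorem pauliCls_labelCons_mem (a : Label₁) :
    pauliCls (labelCons a (0 : Label (n + 1))) ∈ IN (n + 2) := by
  have hX : pauliCls (labelCons (1, 0) (0 : Label (n + 1))) ∈ IN (n + 2) := by
    rw [← single_zero_eq_labelCons, ← cls_cX]
    exact cls_cX_mem
  have hZ : pauliCls (labelCons (0, 1) (0 : Label (n + 1))) ∈ IN (n + 2) := by
    rw [← Prod.swap_prod_mk, ← cls_cH_smul, pauliCls_smul]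
    exact mul_mem (mul_mem cls_cH_mem hX) (inv_mem cls_cH_mem)
  have hcases : ∀ a : Label₁, a = 0 ∨ a = (1, 0) ∨ a = (0, 1) ∨ a = (1, 0) + (0, 1) := by decide
  rcases hcases a with rfl | rfl | rfl | rfl
  · rw [labelCons_zero, pauliCls_zero]
    exact one_mem _
  · exact hX
  · exact hZ
  · rw [← add_zero (0 : Label (n + 1)), ← labelCons_add, pauliCls_add]
    exact mul_mem hX hZ

theorem IN_le_stabilizer :
    IN (n + 2) ≤ MulAction.stabilizer (ProjCliff (n + 2)) (labelY (n + 1)) := by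
  rw [IN_eq_closure, Subgroup.closure_le]
  rintro g ((rfl | rfl | rfl) | ⟨A, rfl⟩)
  · exact cls_M_smul_labelY
  · exact cls_cH_smul _ _
  · change cls (cX 0) • labelY (n + 1) = labelY (n + 1)
    rw [cls_cX, pauliCls_smul_label]
  · change projIdTensor (n + 1) (cls A) • labelCons (1, 1) 0 = labelCons (1, 1) 0
    rw [projIdTensor_smul, smul_label_zero]

/-- The labels of Pauli operators that anticommute with `Y₁`. -/
theorem sign_labelY_eq_neg_one_iff {a : Label₁} {b : Label n} :
    sign (labelY n) (labelCons a b) = -1 ↔ a = (1, 0) ∨ a = (0, 1) := by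
  have key : ∀ a : Label₁, sign₁ (1, 1) a = -1 ↔ a = (1, 0) ∨ a = (0, 1) := by decide
  rw [labelY, sign_labelCons, sign_comm 0, sign_zero_right, mul_one, key]

/-- The subgroup `IN` moves `Z₁` to every Pauli operator that anticommutes with `Y₁`: the operator
`M` maps `Z₁` to `X₁ X₂`, operators `I ⊗ A` change `X₂` to any nontrivial Pauli operator on the
last qubits, and `H₁` exchanges `X₁` and `Z₁`. -/
theorem exists_mem_IN_smul_eq {f : Label (n + 2)} (hf : sign (labelY (n + 1)) f = -1) :
    ∃ g ∈ IN (n + 2), g • labelCons (0, 1) 0 = f := by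
  obtain ⟨a, b, rfl⟩ := exists_labelCons_eq f
  have hX : ∃ g ∈ IN (n + 2), g • labelCons (0, 1) 0 = labelCons (1, 0) b := by
    by_cases hb : b = 0
    · exact ⟨_, cls_cH_mem, by rw [cls_cH_smul, hb, Prod.swap_prod_mk]⟩
    · have hne : (labelCons (1, 0) 0 : Label (n + 1)) ≠ 0 := by
        rw [← labelCons_zero]
        intro h
        exact absurd (labelCons_injective h).1 (by decide)
      obtain ⟨g, hg⟩ := exists_smul_eq hne hb
      refine ⟨projIdTensor (n + 1) g * cls (M n), mul_mem (projIdTensor_mem g) cls_M_mem, ?_⟩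
      rw [mul_smul, cls_M_smul_Z, projIdTensor_smul, hg]
  rcases sign_labelY_eq_neg_one_iff.1 hf with rfl | rfl
  · exact hX
  · obtain ⟨g, hg, h⟩ := hX
    refine ⟨cls (cH (n := n + 2) 0) * g, mul_mem cls_cH_mem hg, ?_⟩
    rw [mul_smul, h, cls_cH_smul, Prod.swap_prod_mk]

theorem sign_labelY_smul {g : ProjCliff (n + 1)} (hg : g • labelY n = labelY n) :
    sign (labelY n) (g • labelCons (0, 1) 0) = -1 := by
  nth_rw 1 [← hg]
  rw [sign_smul_smul, sign_labelY_eq_neg_one_iff]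
  exact Or.inr rfl

/-- An operator fixing both `Y₁` and `Z₁` up to phases also fixes `X₁`. -/
theorem smul_X_eq {g : ProjCliff (n + 1)} (hY : g • labelY n = labelY n)
    (hZ : g • labelCons (0, 1) (0 : Label n) = labelCons (0, 1) 0) :
    g • labelCons (1, 0) (0 : Label n) = labelCons (1, 0) 0 := by
  have h : labelCons (1, 0) (0 : Label n) = labelY n + labelCons (0, 1) 0 := by
    rw [labelY, labelCons_add, add_zero]
    rfl
  rw [h, smul_label_add, hY, hZ]

theorem IN_eq_stabilizer :
    IN (n + 2) = MulAction.stabilizer (ProjCliff (n + 2)) (labelY (n + 1)) := by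
  refine le_antisymm IN_le_stabilizer fun g hg => ?_
  obtain ⟨k, hk, h⟩ := exists_mem_IN_smul_eq (sign_labelY_smul hg)
  have hk' := IN_le_stabilizer hk
  have hY : (k⁻¹ * g) • labelY (n + 1) = labelY (n + 1) := mul_mem (inv_mem hk') hg
  have hZ : (k⁻¹ * g) • labelCons (0, 1) 0 = labelCons (0, 1) (0 : Label (n + 1)) := by
    rw [mul_smul, ← h, inv_smul_smul]
  obtain ⟨a, c, hac⟩ := exists_eq_pauliCls_mul_projIdTensor (smul_X_eq hY hZ) hZ
  rw [inv_mul_eq_iff_eq_mul] at hac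
  rw [hac]
  exact mul_mem hk (mul_mem (pauliCls_labelCons_mem a) (projIdTensor_mem c))

theorem ncard_anticommuting_labelY (n : ℕ) :
    {f : Label (n + 1) | sign (labelY n) f = -1}.ncard = 2 ^ (2 * n + 1) := by
  have h : {f : Label (n + 1) | sign (labelY n) f = -1} =
      (fun p : Label₁ × Label n => labelCons p.1 p.2) ''
        (({(1, 0), (0, 1)} : Set Label₁) ×ˢ Set.univ) := by
    ext f
    obtain ⟨a, b, rfl⟩ := exists_labelCons_eq f
    rw [Set.mem_ofPred_eq, sign_labelY_eq_neg_one_iff]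
    constructor
    · intro ha
      exact ⟨(a, b), ⟨ha, trivial⟩, rfl⟩
    · rintro ⟨⟨a', b'⟩, ⟨ha, -⟩, h⟩
      rw [← (labelCons_injective h).1]
      exact ha
  rw [h, Set.ncard_image_of_injective, Set.ncard_prod, Set.ncard_pair (by decide), Set.ncard_univ]
  · simp only [Nat.card_eq_fintype_card, Fintype.card_pi, Fintype.card_prod, ZMod.card,
      Finset.prod_const, Finset.card_univ, Fintype.card_fin]
    rw [pow_succ, pow_mul, mul_comm]
    norm_num
  · rintro ⟨a, b⟩ ⟨a', b'⟩ h
    obtain ⟨rfl, rfl⟩ := labelCons_injective h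
    rfl

/-- The stabilizer of `Y₁` acts transitively on the labels anticommuting with `Y₁`, and the
stabilizer of `Z₁` for this action is counted by `fixFirstQubitEquiv`. -/
theorem card_stabilizer_labelY (n : ℕ) :
    Nat.card (MulAction.stabilizer (ProjCliff (n + 2)) (labelY (n + 1))) =
      2 ^ (2 * (n + 2) + 1) * Nat.card (ProjCliff (n + 1)) := by
  set S := MulAction.stabilizer (ProjCliff (n + 2)) (labelY (n + 1))
  let z : Label (n + 2) := labelCons (0, 1) 0
  have horb : MulAction.orbit S z = {f | sign (labelY (n + 1)) f = -1} := by
    ext f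
    constructor
    · rintro ⟨g, rfl⟩
      exact sign_labelY_smul g.2
    · intro hf
      obtain ⟨g, hg, h⟩ := exists_mem_IN_smul_eq hf
      exact ⟨⟨g, IN_le_stabilizer hg⟩, h⟩
  let e : MulAction.stabilizer S z ≃
      {g : ProjCliff (n + 2) // g • labelCons (1, 0) (0 : Label (n + 1)) = labelCons (1, 0) 0 ∧
        g • labelCons (0, 1) (0 : Label (n + 1)) = labelCons (0, 1) 0} :=
    { toFun := fun g => ⟨g.1.1, smul_X_eq g.1.2 g.2, g.2⟩
      invFun := fun g => ⟨⟨g.1, by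
        have h : labelY (n + 1) = labelCons (1, 0) 0 + labelCons (0, 1) 0 := by
          rw [labelY, labelCons_add, add_zero]
          rfl
        rw [MulAction.mem_stabilizer_iff, h, smul_label_add, g.2.1, g.2.2]⟩, g.2.2⟩
      left_inv := fun _ => rfl
      right_inv := fun _ => rfl }
  have hcard : Nat.card (MulAction.stabilizer S z) = 4 * Nat.card (ProjCliff (n + 1)) := by
    rw [Nat.card_congr (e.trans (fixFirstQubitEquiv (n + 1)).symm), Nat.card_prod]
    simp [Nat.card_eq_fintype_card]
  rw [← (MulAction.stabilizer S z).card_mul_index, MulAction.index_stabilizer, horb,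
    ncard_anticommuting_labelY, hcard]
  ring

end Qubits

end

theorem mainTheorem4 (n : ℕ) (hn : 2 ≤ n)
    {V : Type*} [AddCommGroup V] [Module ℂ V]
    (σ : Representation ℂ (Qubits.projPauli n) V)
    (hσ : σ.IsIrreducible) (hnt : ¬ σ.IsTrivial) :
    Nonempty (CliffordTheory.inertiaSubgroup (Qubits.projPauli n) σ ≃* Qubits.IN n) ∧
    Finite (Qubits.ProjCliff n) ∧
    (CliffordTheory.inertiaSubgroup (Qubits.projPauli n) σ).index = 4 ^ n - 1 ∧
    Nat.card (CliffordTheory.inertiaSubgroup (Qubits.projPauli n) σ) =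
      2 ^ (2 * n + 1) * Nat.card (Qubits.ProjCliff (n - 1)) ∧
    (Qubits.IN n).index = 4 ^ n - 1 ∧
    Nat.card (Qubits.IN n) = 2 ^ (2 * n + 1) * Nat.card (Qubits.ProjCliff (n - 1)) := by
  obtain ⟨m, rfl⟩ := Nat.exists_eq_add_of_le' hn
  obtain ⟨r, hr⟩ := Qubits.exists_label_of_isIrreducible σ hσ
  have hr0 : r ≠ 0 := by
    rintro rfl
    refine hnt ⟨fun x => ?_⟩
    obtain ⟨a, rfl⟩ := (Qubits.labelEquiv _).surjective x
    rw [hr, Qubits.sign_comm, Qubits.sign_zero_right, Units.val_one, Int.cast_one, one_smul]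
    rfl
  have hV : Nontrivial V := by
    by_contra h
    rw [not_nontrivial_iff_subsingleton] at h
    exact hnt ⟨fun x => LinearMap.ext fun v => Subsingleton.elim _ _⟩
  obtain ⟨g, hg⟩ := Qubits.exists_smul_eq hr0 (Qubits.labelY_ne_zero (n := m + 1))
  have e : MulAction.stabilizer (Qubits.ProjCliff (m + 2)) r ≃*
      MulAction.stabilizer (Qubits.ProjCliff (m + 2)) (Qubits.labelY (m + 1)) :=
    MulAction.stabilizerEquivStabilizer hg.symm
  rw [Qubits.inertiaSubgroup_eq_stabilizer σ r hr, Qubits.IN_eq_stabilizer]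
  exact ⟨⟨e⟩, Qubits.finite_projCliff _, Qubits.index_stabilizer hr0,
    (Nat.card_congr e.toEquiv).trans (Qubits.card_stabilizer_labelY m),
    Qubits.index_stabilizer Qubits.labelY_ne_zero, Qubits.card_stabilizer_labelY m⟩
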